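/- **Theorem.** Let $p\neq 2$ be a prime, $q$ a power of $p$, $n>1$, $K=\mathbb F_{q^n}$, and let $\alpha\in\mathbb F_q$ be an element that is not a square in $\mathbb F_q$. Let $T_1=K(x_1)$ be a rational function field and, for $i\ge 1$, let $T_{i+1}=T_i(x_{i+1})$, where $x_{i+1}$ (taken in an extension field of $T_i$) satisfies $$x_{i+1}^{q^{n-1}}+x_{i+1}^{q^{n-2}}+\dots+x_{i+1}=\frac{1}{\left(x_i^{q^{n-1}}+x_i^{q^{n-2}}+\dots+x_i\right)^2-\alpha}.$$ Then these equations define a tower of function fields over $K$: for every $i\ge 1$ one has $[T_{i+1}:T_i]=q^{n-1}$ (so the equation for $x_{i+1}$ is irreducible over $T_i$), and $K$ is algebraically closed in $T_i$. Moreover: 1. For every $i\ge 1$, $T_i/T_1$ is a finite abelian Galois extension. 2. For all $j\ge i\ge 1$, every rational place of $T_i$ (that is, every place of degree one) splits completely in $T_j$, i.e. there are exactly $[T_j:T_i]$ places of $T_j$ above it. 3. Let $i\ge 1$ and let $P$ be a place of $T_i$ that is ramified in $T_{i+1}$, i.e. $e(P'|P)>1$ for some place $P'$ of $T_{i+1}$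 above $P$. Then $P$ is not rational, and every place $P'$ of $T_{i+1}$ above $P$ splits completely in $T_j$ for every $j\ge i+1$. -/

import Mathlib

namespace FunctionFieldTower

/-- A place of a function field `F / K`, given by its valuation ring: a valuation ring of `F`
that contains the constant field `K` and is different from `F`. -/
structure Place (K F : Type*) [Field K] [Field F] [Algebra K F] where
  /-- the valuation ring `O_P` of the place `P` -/
  ring : ValuationSubring F
  algebraMap_mem : ∀ a : K, algebraMap K F a ∈ ring
  ne_top : ring ≠ ⊤

namespace Place

section Basic

variable {K F : Type*} [Field K] [Field F] [Algebra K F]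

/-- The valuation ring of a place is an algebra over the constant field. -/
instance (P : Place K F) : Algebra K P.ring :=
  ((algebraMap K F).codRestrict P.ring.toSubring P.algebraMap_mem).toAlgebra

/-- The degree of a place: the degree of its residue class field `O_P / m_P` over `K`. -/
noncomputable def degree (P : Place K F) : ℕ :=
  Module.finrank K (IsLocalRing.ResidueField P.ring)

/-- A place is rational if it has degree one. -/
def IsRational (P : Place K F) : Prop := P.degree = 1

end Basic

section Extension

variable {K L : Type*} [Field K] [Field L] [Algebra K L] {F E : IntermediateField K L}

/-- For an extension `E / F` of function fields over `K`, the place `P'` of `E` lies over the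
place `P` of `F`: `O_P = O_P' ∩ F`. -/
def LiesOver (h : F ≤ E) (P' : Place K E) (P : Place K F) : Prop :=
  P'.ring.comap (IntermediateField.inclusion h : F →+* E) = P.ring

/-- If `P'` lies over `P`, the inclusion `F → E` restricts to a ring homomorphism
`O_P → O_P'`. -/
def LiesOver.ringHom {h : F ≤ E} {P' : Place K E} {P : Place K F} (hP : LiesOver h P' P) :
    P.ring →+* P'.ring :=
  (IntermediateField.inclusion h : F →+* E).restrict P.ring.toSubring P'.ring.toSubring
    (fun x hx => by
      have hx' : x ∈ P.ring := hx
      rw [← hP] at hx'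
      exact hx')

/-- The ramification index `e(P'|P)`: the largest `m` with `m_P O_P' ⊆ m_P' ^ m`. -/
noncomputable def LiesOver.ramificationIndex {h : F ≤ E} {P' : Place K E} {P : Place K F}
    (hP : LiesOver h P' P) : ℕ :=
  sSup {m : ℕ | Ideal.map hP.ringHom (IsLocalRing.maximalIdeal P.ring) ≤
    IsLocalRing.maximalIdeal P'.ring ^ m}

/-- The place `P` of `F` is ramified in `E / F`: `e(P'|P) > 1` for some place `P'` of `E`
over `P`. -/
def IsRamifiedIn (h : F ≤ E) (P : Place K F) : Prop :=
  ∃ (P' : Place K E) (hP : LiesOver h P' P), 1 < hP.ramificationIndex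

/-- The place `P` of `F` splits completely in `E / F`: the extension is finite and there are
exactly `[E : F]` places of `E` over `P`. -/
def SplitsCompletelyIn (h : F ≤ E) (P : Place K F) : Prop :=
  FiniteDimensional F (IntermediateField.extendScalars h) ∧
    {P' : Place K E | LiesOver h P' P}.encard =
      (Module.finrank F (IntermediateField.extendScalars h) : ℕ∞)

end Extension

end Place

section Tower

variable (K : Type*) {L : Type*} [Field K] [Field L] [Algebra K L]

/-- The `i`-th field `T_i = K(x_1, …, x_i)` of the tower generated by `x_1, x_2, …` (so
`T_1 = K(x_1)` and `T_{i+1} = T_i(x_{i+1})`). -/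
def towerField (x : ℕ → L) (i : ℕ) : IntermediateField K L :=
  IntermediateField.adjoin K (x '' Set.Icc 1 i)

theorem towerField_mono (x : ℕ → L) : Monotone (towerField K x) := fun _ _ hij =>
  IntermediateField.adjoin.mono K _ _ (Set.image_mono (Set.Icc_subset_Icc_right hij))

/-- The trace polynomial `y ^ (q ^ (n - 1)) + y ^ (q ^ (n - 2)) + ⋯ + y ^ q + y`. -/
def traceSum (q n : ℕ) (y : L) : L := ∑ j ∈ Finset.range n, y ^ q ^ j

end Tower

end FunctionFieldTower

/-!
Write `S(y) = y ^ (q ^ (n - 1)) + ⋯ + y ^ q + y` and `z_i = S(x_i)`. On `K` the map `S` is the trace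
to `k`: it is onto `k`, and its `q ^ (n - 1)` zeros all lie in `K`. The recursion reads
`z_{i+1} = 1 / (z_i ^ 2 - α)`, so all the `z_j` with `j ≥ i` are rational functions of `z_i`, and
`T_j` is obtained from `T_i` by adjoining solutions of the equations `S(X) = z_l` with `z_l ∈ T_i`.
The conjugates of a solution are its translates by constants of trace zero; hence `T_j / T_i` is
finite abelian (`HasTraceKernel.isAbelianGalois`).

*Degrees and constants.* The tower is expanded in power series around a point of the `x_1`-line.
By Hensel's lemma every equation `S(X) = ζ` with a power series `ζ` is solvable if it is solvable
for the constant term, so the expansion embeds `T_i` into the fraction field of `Ω⟦X⟧`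
(`exists_algHom_fractionRing_powerSeries`). Over `Ω = K`, at the point `x_1 = 0`, all the `z_j` take
values in `k`, and the constants of `T_i` embed into constants of `K⟦X⟧`, which gives
`mem_range_algebraMap_of_isAlgebraic`. Over an algebraic closure, the expansion at a point where
`z_i = √α` has `z_i ^ 2 - α` of order exactly one: the orbit leading to `√α` avoids the critical
point `0`, since an orbit through `k` never leaves `k`. Therefore the polynomial of `1 / x_{i+1}` is
Eisenstein, and `x_{i+1}` has degree `q ^ (n - 1)` (`finrank_towerField_succ`).

*Splitting.* Suppose that `z_i` has a residue in `k`, or a pole, at a place `P` of `T_i`. Then `z_l`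
has a residue in `k` for all `l > i`, because `α` is not a square in `k`; so the residues of the
`x_l` at the places above `P` lie in `K`. An automorphism that fixes such a place fixes the residues
of the `x_l`, and as it translates the `x_l` by constants it is trivial. The Galois group permutes
the valuation rings above `P` transitively (`exists_smul_eq`), so there are `[T_j : T_i]` of them
(`splitsCompletelyIn_of_traceResidueIn`). Rational places satisfy the assumption.

*Ramification.* If `z_{i+1}` is regular at `P`, the conjugates of `x_{i+1}` remain distinct modulo
every place above `P`, and Lagrange interpolation at these conjugates shows that the maximal ideal
of `P` generates that of each place above it (`exists_eq_sum_mul_of_mem_nonunits`). So a ramified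
place is a pole of `z_{i+1}`. It is not rational, and the places of `T_{i+1}` above it split
completely by the previous paragraph.
-/

/-! ### Valuation rings in finite Galois extensions -/

namespace FunctionFieldTower

open Polynomial
open scoped Pointwise

section Valuative

variable {F E : Type*} [Field F] [Field E] [Algebra F E]

/-- The intersection of all valuation rings of `E` that contain the valuation ring `O` of `F`
(this is the integral closure of `O` in `E`). -/
def holomorphyRing (E : Type*) [Field E] [Algebra F E] (O : ValuationSubring F) : Subring E :=
  ⨅ V : {V : ValuationSubring E // O ≤ V.comap (algebraMap F E)}, V.1.toSubring

theorem mem_holomorphyRing {O : ValuationSubring F} {y : E} :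
    y ∈ holomorphyRing E O ↔
      ∀ V : ValuationSubring E, O ≤ V.comap (algebraMap F E) → y ∈ V := by
  simp [holomorphyRing, Subring.mem_iInf]

theorem aeval_mem_of_coeff_mem {O : ValuationSubring F} {V : ValuationSubring E}
    (hV : O ≤ V.comap (algebraMap F E)) {y : E} (hy : y ∈ V) {f : F[X]}
    (hf : ∀ i, f.coeff i ∈ O) : aeval y f ∈ V := by
  rw [aeval_eq_sum_range]
  refine sum_mem fun i _ => ?_
  rw [Algebra.smul_def]
  exact mul_mem (hV (hf i)) (pow_mem hy i)

/-- An algebraic element satisfies an equation over `O` with a coefficient equal to `1`: divide by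
a coefficient of maximal valuation. -/
theorem exists_primitive_aeval_eq_zero (O : ValuationSubring F) {y : E} (hy : IsAlgebraic F y) :
    ∃ f : F[X], aeval y f = 0 ∧ (∀ i, f.coeff i ∈ O) ∧ ∃ i, f.coeff i = 1 := by
  obtain ⟨f, hf0, hf⟩ := hy
  obtain ⟨m, hm, hmax⟩ := f.support.exists_max_image (fun i => O.valuation (f.coeff i))
    (support_nonempty.2 hf0)
  have hm0 : f.coeff m ≠ 0 := mem_support_iff.1 hm
  refine ⟨C (f.coeff m)⁻¹ * f, by simp [hf], fun i => ?_, m, by simp [hm0]⟩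
  rw [coeff_C_mul]
  by_cases hi : f.coeff i = 0
  · simp [hi]
  · rw [← O.valuation_le_one_iff, map_mul, map_inv₀]
    have := hmax i (mem_support_iff.2 hi)
    have h0 : O.valuation (f.coeff m) ≠ 0 := (_root_.map_ne_zero _).2 hm0
    calc _ ≤ (O.valuation (f.coeff m))⁻¹ * O.valuation (f.coeff m) := by gcongr
      _ = 1 := inv_mul_cancel₀ h0

/-- A valuation ring of `E` above `O` is the localisation of the integral closure of `O` at a
prime. The denominators are the Horner values of a primitive equation satisfied by `y`: both they
and their products with `y` lie in every valuation ring above `O`. -/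
theorem exists_mul_mem_holomorphyRing {O : ValuationSubring F} {V : ValuationSubring E}
    {y : E} (hy : y ∈ V) (halg : IsAlgebraic F y) :
    ∃ s ∈ holomorphyRing E O, s ∉ V.nonunits ∧ s * y ∈ holomorphyRing E O := by
  obtain ⟨f, hf, hfO, i₀, hi₀⟩ := exists_primitive_aeval_eq_zero O halg
  set h : ℕ → E := fun m => aeval y (divX^[m] f) with hh
  have hcoeff : ∀ m i, (divX^[m] f).coeff i = f.coeff (i + m) := by
    intro m
    induction m with
    | zero => simp
    | succ m ih => intro i; rw [Function.iterate_succ_apply', coeff_divX, ih]; congr 1; ring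
  have hrec : ∀ m, h m = h (m + 1) * y + algebraMap F E (f.coeff m) := by
    intro m
    conv_lhs => rw [hh]; simp only; rw [← divX_mul_X_add (divX^[m] f)]
    rw [map_add, map_mul, aeval_X, aeval_C, hcoeff, zero_add, hh]
    simp only [Function.iterate_succ_apply']
  have hmem : ∀ m, h m ∈ holomorphyRing E O := by
    intro m
    rw [mem_holomorphyRing]
    intro W hW
    by_cases hyW : y ∈ W
    · exact aeval_mem_of_coeff_mem hW hyW fun i => by rw [hcoeff]; exact hfO _
    · have hyi : y⁻¹ ∈ W := (W.mem_or_inv_mem y).resolve_left hyW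
      have hy0 : y ≠ 0 := by rintro rfl; exact hyW W.zero_mem
      induction m with
      | zero => simp [hh, hf]
      | succ m ih =>
        have : h (m + 1) = (h m - algebraMap F E (f.coeff m)) * y⁻¹ := by
          rw [hrec m]; field_simp; ring
        rw [this]
        exact mul_mem (sub_mem ih (hW (hfO m))) hyi
  by_contra! hcon
  have hnon : ∀ m, h m ∈ V.nonunits := by
    intro m
    by_contra hm
    cases m with
    | zero => exact hm (by simp [hh, hf])
    | succ m =>
      refine hcon _ (hmem (m + 1)) hm ?_
      have : h (m + 1) * y = h m - algebraMap F E (f.coeff m) := by rw [hrec m]; ring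
      rw [this]
      exact sub_mem (hmem m) (mem_holomorphyRing.2 fun W hW => hW (hfO m))
  have h1 : (1 : E) = h i₀ - h (i₀ + 1) * y := by rw [hrec i₀, hi₀]; simp
  have : (1 : E) ∈ V.nonunits := by
    rw [h1]
    refine sub_mem (hnon _) ?_
    have h2 := hnon (i₀ + 1)
    rw [ValuationSubring.mem_nonunits_iff] at h2 ⊢
    rw [map_mul]
    exact mul_lt_one_of_lt_of_le h2 ((V.valuation_le_one_iff y).2 hy)
  simp [ValuationSubring.mem_nonunits_iff] at this

/-- Inclusions between the centres on the integral closure of `O` reverse to inclusions between the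
valuation rings, since these are localisations of it. -/
theorem le_of_nonunits_inter_holomorphyRing_le [Algebra.IsAlgebraic F E]
    {O : ValuationSubring F} {V W : ValuationSubring E}
    (hW : O ≤ W.comap (algebraMap F E))
    (h : ∀ b ∈ holomorphyRing E O, b ∈ W.nonunits → b ∈ V.nonunits) : V ≤ W := by
  intro y hy
  obtain ⟨s, hs, hsV, hsy⟩ := exists_mul_mem_holomorphyRing (O := O) hy
    (Algebra.IsAlgebraic.isAlgebraic y)
  have hsW : s ∉ W.nonunits := fun hsW => hsV (h s hs hsW)
  rw [ValuationSubring.mem_nonunits_iff_or] at hsW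
  push Not at hsW
  have : y = s * y * s⁻¹ := by field_simp [hsW.1]
  rw [this]
  exact mul_mem (mem_holomorphyRing.1 hsy W hW) hsW.2

theorem smul_eq_of_smul_le {G : Type*} [Group G] [Finite G] [MulSemiringAction G E]
    {g : G} {V : ValuationSubring E} (h : g • V ≤ V) : g • V = V := by
  have hpow : ∀ m : ℕ, g ^ m • V ≤ V := by
    intro m
    induction m with
    | zero => simp
    | succ m ih =>
      rw [pow_succ, mul_smul]
      exact ((ValuationSubring.pointwise_smul_le_pointwise_smul_iff).2 h).trans ih
  refine le_antisymm h ?_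
  rw [ValuationSubring.subset_pointwise_smul_iff]
  obtain ⟨m, hm⟩ : ∃ m : ℕ, g⁻¹ = g ^ m := by
    refine ⟨orderOf g - 1, ?_⟩
    rw [inv_eq_iff_mul_eq_one, ← pow_succ', Nat.sub_add_cancel (orderOf_pos g), pow_orderOf_eq_one]
  rw [hm]
  exact hpow m

theorem comap_smul (σ : Gal(E/F)) (V : ValuationSubring E) :
    (σ • V).comap (algebraMap F E) = V.comap (algebraMap F E) := by
  ext a
  rw [ValuationSubring.mem_comap, ValuationSubring.mem_comap,
    ValuationSubring.mem_pointwise_smul_iff_inv_smul_mem, AlgEquiv.smul_def, AlgEquiv.commutes]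

theorem mem_nonunits_smul_iff {σ : Gal(E/F)} {V : ValuationSubring E} {y : E} :
    y ∈ (σ • V).nonunits ↔ σ⁻¹ y ∈ V.nonunits := by
  rw [ValuationSubring.mem_nonunits_iff_or, ValuationSubring.mem_nonunits_iff_or,
    ValuationSubring.mem_pointwise_smul_iff_inv_smul_mem, AlgEquiv.smul_def, map_inv₀]
  simp

theorem smul_mem_holomorphyRing {O : ValuationSubring F} (σ : Gal(E/F)) {y : E}
    (hy : y ∈ holomorphyRing E O) : σ y ∈ holomorphyRing E O := by
  rw [mem_holomorphyRing] at hy ⊢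
  intro V hV
  have := hy (σ⁻¹ • V) (by rwa [comap_smul])
  rwa [ValuationSubring.mem_inv_pointwise_smul_iff] at this

theorem algebraMap_mem_nonunits_iff {O : ValuationSubring F} {V : ValuationSubring E}
    (hV : V.comap (algebraMap F E) = O) {a : F} :
    algebraMap F E a ∈ V.nonunits ↔ a ∈ O.nonunits := by
  rw [ValuationSubring.mem_nonunits_iff_or, ValuationSubring.mem_nonunits_iff_or, ← hV,
    ValuationSubring.mem_comap, map_inv₀]
  simp

/-- The centre of `V` on the integral closure of `O`. -/
def center (O : ValuationSubring F) (V : ValuationSubring E)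
    (hV : O ≤ V.comap (algebraMap F E)) : Ideal (holomorphyRing E O) :=
  (IsLocalRing.maximalIdeal V).comap
    (Subring.inclusion (T := V.toSubring) fun _ hy => mem_holomorphyRing.1 hy V hV)

theorem mem_center {O : ValuationSubring F} {V : ValuationSubring E}
    {hV : O ≤ V.comap (algebraMap F E)} {b : holomorphyRing E O} :
    b ∈ center O V hV ↔ (b : E) ∈ V.nonunits := by
  rw [center, Ideal.mem_comap, ← ValuationSubring.coe_mem_nonunits_iff]; rfl

instance {O : ValuationSubring F} {V : ValuationSubring E}
    {hV : O ≤ V.comap (algebraMap F E)} : (center O V hV).IsPrime :=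
  Ideal.IsPrime.comap _

theorem exists_algebraMap_eq_of_forall_smul_eq [FiniteDimensional F E] [IsGalois F E] {y : E}
    (h : ∀ σ : Gal(E/F), σ y = y) : ∃ a : F, algebraMap F E a = y :=
  (IsGalois.mem_range_algebraMap_iff_fixed y).2 h

/-- Prime avoidance on the integral closure: an element of the centre of `W` that lies in no
centre of the conjugates of `V` would have a norm that is both a unit and a non-unit of `O`. -/
theorem exists_smul_le [FiniteDimensional F E] [IsGalois F E] {O : ValuationSubring F}
    {V W : ValuationSubring E} (hV : V.comap (algebraMap F E) = O)
    (hW : W.comap (algebraMap F E) = O) : ∃ σ : Gal(E/F), σ • V ≤ W := by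
  classical
  have hσV : ∀ σ : Gal(E/F), O ≤ (σ • V).comap (algebraMap F E) := fun σ => by
    rw [comap_smul, hV]
  have hsub : (center O W hW.ge : Set (holomorphyRing E O)) ⊆
      ⋃ σ ∈ ((Finset.univ : Finset Gal(E/F)) : Set Gal(E/F)), center O (σ • V) (hσV σ) := by
    intro b hb
    have hbW : (b : E) ∈ W.nonunits := mem_center.1 hb
    by_contra hcon
    have hcon' : ∀ σ : Gal(E/F), σ (b : E) ∉ V.nonunits := by
      intro σ hσ
      refine hcon (Set.mem_biUnion (x := σ⁻¹) (by simp) ?_)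
      exact mem_center.2 (mem_nonunits_smul_iff.2 (by simpa using hσ))
    -- the norm of `b` lies in `F`, is a unit at `V` and a non-unit at `W`
    obtain ⟨a, ha⟩ := exists_algebraMap_eq_of_forall_smul_eq (F := F)
      (y := ∏ σ : Gal(E/F), σ (b : E)) fun τ => by
        rw [map_prod]
        exact Fintype.prod_equiv (Equiv.mulLeft τ) _ _ fun σ => rfl
    have h1 : a ∉ O.nonunits := by
      rw [← algebraMap_mem_nonunits_iff hV, ha, ValuationSubring.mem_nonunits_iff, map_prod, not_lt]
      refine Finset.one_le_prod'' fun σ => ?_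
      have := hcon' σ
      rwa [ValuationSubring.mem_nonunits_iff, not_lt] at this
    refine h1 ?_
    rw [← algebraMap_mem_nonunits_iff hW, ha, ← Finset.mul_prod_erase _ _ (Finset.mem_univ 1),
      ValuationSubring.mem_nonunits_iff, map_mul]
    refine mul_lt_one_of_lt_of_le hbW ?_
    rw [ValuationSubring.valuation_le_one_iff]
    exact prod_mem fun σ _ => mem_holomorphyRing.1 (smul_mem_holomorphyRing σ b.2) W hW.ge
  rw [Ideal.subset_union_prime 1 1 fun σ _ _ _ => inferInstance] at hsub
  obtain ⟨σ, -, hσ⟩ := hsub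
  refine ⟨σ, le_of_nonunits_inter_holomorphyRing_le hW.ge fun b hb hbW => ?_⟩
  exact mem_center.1 (@hσ ⟨b, hb⟩ (mem_center.2 hbW))

/-- The Galois group acts transitively on the valuation rings above `O`. -/
theorem exists_smul_eq [FiniteDimensional F E] [IsGalois F E] {O : ValuationSubring F}
    {V W : ValuationSubring E} (hV : V.comap (algebraMap F E) = O)
    (hW : W.comap (algebraMap F E) = O) : ∃ σ : Gal(E/F), σ • V = W := by
  obtain ⟨σ, hσ⟩ := exists_smul_le hV hW
  obtain ⟨τ, hτ⟩ := exists_smul_le hW hV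
  refine ⟨σ, le_antisymm hσ ?_⟩
  have h1 : (τ * σ) • V ≤ V := by
    rw [mul_smul]
    exact ((ValuationSubring.pointwise_smul_le_pointwise_smul_iff).2 hσ).trans hτ
  have h2 := smul_eq_of_smul_le h1
  rw [← ValuationSubring.pointwise_smul_le_pointwise_smul_iff (g := τ), ← mul_smul, h2]
  exact hτ

theorem exists_comap_eq (O : ValuationSubring F) :
    ∃ V : ValuationSubring E, V.comap (algebraMap F E) = O := by
  let e := O.toSubring.equivMapOfInjective (algebraMap F E) (algebraMap F E).injective
  obtain ⟨V, hV, hV'⟩ := Ideal.image_subset_nonunits_valuationSubring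
    ((IsLocalRing.maximalIdeal O).comap e.symm.toRingHom)
    (Ideal.IsPrime.ne_top (Ideal.IsPrime.comap _))
  refine ⟨V, le_antisymm (fun a ha => ?_) fun a ha => hV ⟨a, ha, rfl⟩⟩
  by_contra haO
  have ha' : a⁻¹ ∈ O.nonunits := (O.inv_mem_nonunits_iff).2 (Or.inr haO)
  have haV : algebraMap F E a⁻¹ ∈ V.nonunits := by
    obtain ⟨h1, h2⟩ := O.mem_nonunits_iff_exists_mem_maximalIdeal.1 ha'
    refine hV' ⟨e ⟨a⁻¹, h1⟩, ?_, rfl⟩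
    simpa using h2
  rw [map_inv₀, V.inv_mem_nonunits_iff] at haV
  rcases haV with h0 | h
  · rw [_root_.map_eq_zero] at h0
    exact haO (h0 ▸ O.zero_mem)
  · exact h ha

/-- If the decomposition groups are trivial, the number of valuation rings above `O` is the degree
of the extension. -/
theorem encard_comap_eq [FiniteDimensional F E] [IsGalois F E] {O : ValuationSubring F}
    (hstab : ∀ V : ValuationSubring E, V.comap (algebraMap F E) = O →
      ∀ σ : Gal(E/F), σ • V = V → σ = 1) :
    {V : ValuationSubring E | V.comap (algebraMap F E) = O}.encard = Module.finrank F E := by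
  obtain ⟨V, hV⟩ := exists_comap_eq (E := E) O
  have hset : {W : ValuationSubring E | W.comap (algebraMap F E) = O} =
      Set.range fun σ : Gal(E/F) => σ • V := by
    ext W
    constructor
    · exact fun hW => exists_smul_eq hV hW
    · rintro ⟨σ, rfl⟩
      exact (comap_smul σ V).trans hV
  have hinj : Function.Injective fun σ : Gal(E/F) => σ • V := fun σ τ h => by
    have : (τ⁻¹ * σ) • V = V := by
      rw [mul_smul]; simp only at h; rw [h, inv_smul_smul]
    rw [← inv_mul_eq_one.1 (hstab V hV _ this)]
  rw [hset, ← Set.image_univ, hinj.encard_image, Set.encard_univ, ← IsGalois.card_aut_eq_finrank,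
    ENat.card_eq_coe_natCard]

theorem exists_of_prod_mem_nonunits {ι : Type*} {V : ValuationSubring E} {s : Finset ι}
    {f : ι → E} (h : ∏ i ∈ s, f i ∈ V.nonunits) : ∃ i ∈ s, f i ∈ V.nonunits := by
  by_contra! hcon
  rw [ValuationSubring.mem_nonunits_iff, map_prod, ← not_le] at h
  refine h (Finset.one_le_prod' fun i hi => ?_)
  have := hcon i hi
  rwa [ValuationSubring.mem_nonunits_iff, not_lt] at this

theorem mul_mem_nonunits {V : ValuationSubring E} {a b : E} (ha : a ∈ V) (hb : b ∈ V.nonunits) :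
    a * b ∈ V.nonunits := by
  rw [ValuationSubring.mem_nonunits_iff] at hb ⊢
  rw [map_mul, mul_comm]
  exact mul_lt_one_of_lt_of_le hb ((V.valuation_le_one_iff a).2 ha)

/-- An element that is a unit at `V` and a non-unit at all the other conjugates of `V`. -/
theorem exists_mem_nonunits_of_smul_ne [FiniteDimensional F E] {O : ValuationSubring F}
    {V : ValuationSubring E} (hV : V.comap (algebraMap F E) = O) :
    ∃ e ∈ holomorphyRing E O, e ∉ V.nonunits ∧
      ∀ σ : Gal(E/F), σ • V ≠ V → e ∈ (σ • V).nonunits := by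
  classical
  have key : ∀ σ : Gal(E/F), σ • V ≠ V →
      ∃ e ∈ holomorphyRing E O, e ∉ V.nonunits ∧ e ∈ (σ • V).nonunits := by
    intro σ hσ
    by_contra! hcon
    have hle : V ≤ σ • V := le_of_nonunits_inter_holomorphyRing_le (O := O)
      (by rw [comap_smul, hV]) fun b hb hbσ => by
        by_contra hbV
        exact hcon b hb hbV hbσ
    rw [ValuationSubring.subset_pointwise_smul_iff] at hle
    exact hσ (inv_smul_eq_iff.1 (smul_eq_of_smul_le hle)).symm
  -- the product over all conjugates different from `V` has the required property
  choose! e heB heV heσ using key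
  refine ⟨∏ σ with σ • V ≠ V, e σ, prod_mem fun σ hσ => heB σ (by simpa using hσ), fun h => ?_,
    fun σ hσ => ?_⟩
  · obtain ⟨σ, hσ, h⟩ := exists_of_prod_mem_nonunits h
    exact heV σ (by simpa using hσ) h
  · rw [← Finset.prod_erase_mul _ _ (a := σ) (by simpa using hσ)]
    refine mul_mem_nonunits (prod_mem fun τ hτ => ?_) (heσ σ hσ)
    have hτ' : τ • V ≠ V := by simpa using (Finset.mem_erase.1 hτ).2
    exact mem_holomorphyRing.1 (heB τ hτ') _ (by rw [comap_smul, hV])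

/-- Lagrange interpolation at the conjugates of `x`: if all conjugates of `b` are non-units at `V`,
then `b` is a polynomial in `x` with coefficients in the maximal ideal of `O`. -/
theorem exists_eq_sum_of_forall_mem_nonunits [FiniteDimensional F E] [IsGalois F E]
    {O : ValuationSubring F} {V : ValuationSubring E} (hV : V.comap (algebraMap F E) = O) {x : E}
    (hx : x ∈ holomorphyRing E O)
    (hne : ∀ σ : Gal(E/F), σ ≠ 1 → σ x ≠ x)
    (hunit : ∀ σ : Gal(E/F), σ ≠ 1 → (x - σ x)⁻¹ ∈ holomorphyRing E O)
    {b : E} (hb : ∀ σ : Gal(E/F), σ b ∈ V.nonunits) :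
    ∃ f : F[X], (∀ i, f.coeff i ∈ O.nonunits) ∧ aeval x f = b := by
  classical
  set h : E[X] := ∏ τ : Gal(E/F) with τ ≠ 1, (X - C (τ x)) with hh
  set δ : E := ∏ τ : Gal(E/F) with τ ≠ 1, (x - τ x) with hδ
  have hδ0 : δ ≠ 0 := Finset.prod_ne_zero_iff.2 fun τ hτ =>
    sub_ne_zero.2 (hne τ (by simpa using hτ)).symm
  have hδB : δ⁻¹ ∈ holomorphyRing E O := by
    rw [hδ, ← Finset.prod_inv_distrib]
    exact prod_mem fun τ hτ => hunit τ (by simpa using hτ)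
  have hhB : ∀ i, h.coeff i ∈ holomorphyRing E O := by
    have hl : h ∈ lifts (holomorphyRing E O).subtype := by
      refine prod_mem fun τ _ => ?_
      rw [sub_eq_add_neg, ← C_neg]
      exact add_mem (X_mem_lifts _) (C_mem_lifts (holomorphyRing E O).subtype
        ⟨-τ x, neg_mem (smul_mem_holomorphyRing τ hx)⟩)
    intro i
    obtain ⟨c, hc⟩ := (lifts_iff_coeff_lifts _).1 hl i
    exact hc ▸ c.2
  have hcoeff : ∀ i, ∃ a : F, algebraMap F E a = ∑ σ : Gal(E/F), σ (b * (δ⁻¹ * h.coeff i)) := by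
    intro i
    refine exists_algebraMap_eq_of_forall_smul_eq fun τ => ?_
    rw [map_sum]
    exact Fintype.sum_equiv (Equiv.mulLeft τ) _ _ fun σ => rfl
  -- the interpolation polynomial is `∑ σ, σ (b * δ⁻¹ * h)`, so its coefficients are traces
  choose a ha using hcoeff
  refine ⟨∑ i ∈ Finset.range (h.natDegree + 1), monomial i (a i), fun i => ?_, ?_⟩
  · have haO : ∀ i, a i ∈ O.nonunits := by
      intro i
      rw [← algebraMap_mem_nonunits_iff hV, ha]
      refine sum_mem fun σ _ => ?_
      rw [map_mul, mul_comm]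
      exact mul_mem_nonunits (mem_holomorphyRing.1
        (smul_mem_holomorphyRing σ (mul_mem hδB (hhB i))) V hV.ge) (hb σ)
    rw [finsetSum_coeff]
    refine sum_mem fun j _ => ?_
    rw [coeff_monomial]
    split_ifs
    · exact haO j
    · exact zero_mem _
  · rw [map_sum]
    simp only [aeval_monomial, ha, Finset.sum_mul]
    rw [Finset.sum_comm, ← Finset.add_sum_erase _ _ (Finset.mem_univ 1)]
    have hev : ∀ σ : Gal(E/F), ∑ i ∈ Finset.range (h.natDegree + 1),
        σ (b * (δ⁻¹ * h.coeff i)) * x ^ i = σ (b * δ⁻¹) * (h.map (σ : E →+* E)).eval x := by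
      intro σ
      rw [eval_map, eval₂_eq_sum_range, Finset.mul_sum]
      exact Finset.sum_congr rfl fun i _ => by simp [mul_assoc]
    rw [hev 1, Finset.sum_eq_zero fun σ hσ => ?_, add_zero]
    · have : (h.map ((1 : Gal(E/F)) : E →+* E)).eval x = δ := by
        rw [hh, hδ, Polynomial.map_prod, eval_prod]
        simp
      rw [this, AlgEquiv.one_apply, mul_assoc, inv_mul_cancel₀ hδ0, mul_one]
    · have hσ1 : σ ≠ 1 := (Finset.mem_erase.1 hσ).1
      rw [hev, hh, Polynomial.map_prod, eval_prod,
        Finset.prod_eq_zero (i := σ⁻¹) (by simpa using hσ1), mul_zero]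
      simp

/-- The maximal ideal of `O` generates that of `V` when `x` is integral over `O` and its
conjugates stay distinct modulo all the places above `O`. -/
theorem exists_eq_sum_mul_of_mem_nonunits [FiniteDimensional F E] [IsGalois F E]
    {O : ValuationSubring F} {V : ValuationSubring E} (hV : V.comap (algebraMap F E) = O) {x : E}
    (hx : x ∈ holomorphyRing E O)
    (hne : ∀ σ : Gal(E/F), σ ≠ 1 → σ x ≠ x)
    (hunit : ∀ σ : Gal(E/F), σ ≠ 1 → (x - σ x)⁻¹ ∈ holomorphyRing E O)
    {y : E} (hy : y ∈ V.nonunits) :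
    ∃ (N : ℕ) (a : ℕ → F) (w : ℕ → E), (∀ i, a i ∈ O.nonunits) ∧ (∀ i, w i ∈ V) ∧
      y = ∑ i ∈ Finset.range N, algebraMap F E (a i) * w i := by
  obtain ⟨s, hs, hsV, hsy⟩ := exists_mul_mem_holomorphyRing (O := O)
    (V.nonunits_subset hy) (Algebra.IsAlgebraic.isAlgebraic y)
  obtain ⟨e, he, heV, heσ⟩ := exists_mem_nonunits_of_smul_ne hV
  have hb : ∀ σ : Gal(E/F), σ (e * (s * y)) ∈ V.nonunits := by
    intro σ
    have h1 : e * (s * y) ∈ (σ⁻¹ • V).nonunits := by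
      have hle : O ≤ (σ⁻¹ • V).comap (algebraMap F E) := by rw [comap_smul, hV]
      by_cases hσ : σ⁻¹ • V = V
      · rw [hσ, ← mul_assoc]
        exact mul_mem_nonunits (mem_holomorphyRing.1 (mul_mem he hs) V hV.ge) hy
      · rw [mul_comm]
        exact mul_mem_nonunits (mem_holomorphyRing.1 hsy _ hle) (heσ _ hσ)
    simpa using mem_nonunits_smul_iff.1 h1
  obtain ⟨f, hf, hfx⟩ := exists_eq_sum_of_forall_mem_nonunits hV hx hne hunit hb
  have hes : e * s ∉ V.nonunits := by
    rw [ValuationSubring.mem_nonunits_iff, not_lt] at heV hsV ⊢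
    rw [map_mul]
    exact one_le_mul heV hsV
  rw [ValuationSubring.mem_nonunits_iff_or, not_or, not_not] at hes
  refine ⟨f.natDegree + 1, f.coeff, fun i => x ^ i * (e * s)⁻¹, hf, fun i =>
    mul_mem (pow_mem (mem_holomorphyRing.1 hx V hV.ge) i) hes.2, ?_⟩
  simp only [← mul_assoc, ← Finset.sum_mul]
  rw [eq_mul_inv_iff_mul_eq₀ hes.1]
  rw [aeval_eq_sum_range] at hfx
  simp only [Algebra.smul_def] at hfx
  rw [hfx]; ring

end Valuative
end FunctionFieldTower

/-! ### The trace polynomial -/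

namespace FunctionFieldTower

open Polynomial

section TracePoly

/-- The polynomial `X ^ (q ^ (n - 1)) + ⋯ + X ^ q + X` whose values are given by `traceSum`. -/
noncomputable def tracePoly (R : Type*) [CommRing R] (q n : ℕ) : R[X] :=
  ∑ j ∈ Finset.range n, X ^ q ^ j

theorem eval_tracePoly {E : Type*} [Field E] (q n : ℕ) (y : E) :
    (tracePoly E q n).eval y = traceSum q n y := by
  simp [tracePoly, traceSum, eval_finsetSum]

theorem map_tracePoly {R S : Type*} [CommRing R] [CommRing S] (f : R →+* S) (q n : ℕ) :
    (tracePoly R q n).map f = tracePoly S q n := by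
  simp [tracePoly, Polynomial.map_sum]

theorem map_eval_tracePoly {R S : Type*} [CommRing R] [CommRing S] (f : R →+* S) (q n : ℕ)
    (y : R) : f ((tracePoly R q n).eval y) = (tracePoly S q n).eval (f y) := by
  simp [tracePoly, eval_finsetSum, map_sum]

theorem map_traceSum {E M : Type*} [Field E] [Field M] (f : E →+* M) (q n : ℕ) (y : E) :
    f (traceSum q n y) = traceSum q n (f y) := by
  simp [traceSum, map_sum]

theorem degree_tracePoly_lt {R : Type*} [CommRing R] [Nontrivial R] {q n : ℕ} (hq : 1 < q) :
    (tracePoly R q n).degree < (q ^ n : ℕ) := by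
  refine (degree_sum_le _ _).trans_lt ((Finset.sup_lt_iff (WithBot.bot_lt_coe _)).2 fun j hj => ?_)
  rw [degree_X_pow]
  exact_mod_cast Nat.pow_lt_pow_right hq (Finset.mem_range.1 hj)

theorem tracePoly_succ {R : Type*} [CommRing R] (q n : ℕ) :
    tracePoly R q (n + 1) = X ^ q ^ n + tracePoly R q n := by
  rw [tracePoly, Finset.sum_range_succ, add_comm]; rfl

theorem monic_tracePoly_sub_C {R : Type*} [CommRing R] {q n : ℕ} (hq : 1 < q)
    (hn : 0 < n) (c : R) : (tracePoly R q n - C c).Monic := by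
  nontriviality R
  obtain ⟨m, rfl⟩ := Nat.exists_eq_succ_of_ne_zero hn.ne'
  rw [Nat.succ_eq_add_one, tracePoly_succ, add_sub_assoc]
  refine monic_X_pow_add ((degree_sub_le _ _).trans_lt (max_lt (degree_tracePoly_lt hq) ?_))
  exact degree_C_le.trans_lt (by exact_mod_cast pow_pos (by omega) m)

theorem natDegree_tracePoly_sub_C {R : Type*} [CommRing R] [Nontrivial R] {q n : ℕ} (hq : 1 < q)
    (hn : 0 < n) (c : R) : (tracePoly R q n - C c).natDegree = q ^ (n - 1) := by
  obtain ⟨m, rfl⟩ := Nat.exists_eq_succ_of_ne_zero hn.ne'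
  rw [Nat.succ_eq_add_one, tracePoly_succ, add_sub_assoc, Nat.add_sub_cancel]
  refine natDegree_eq_of_degree_eq_some ?_
  rw [degree_add_eq_left_of_degree_lt, degree_X_pow]
  rw [degree_X_pow]
  refine (degree_sub_le _ _).trans_lt (max_lt (degree_tracePoly_lt hq) ?_)
  exact degree_C_le.trans_lt (by exact_mod_cast pow_pos (by omega) m)

theorem derivative_tracePoly {R : Type*} [CommRing R] {q n : ℕ} (hq : (q : R) = 0) (hn : 0 < n) :
    derivative (tracePoly R q n) = 1 := by
  obtain ⟨m, rfl⟩ := Nat.exists_eq_succ_of_ne_zero hn.ne'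
  rw [tracePoly, Finset.sum_range_succ', derivative_add, derivative_sum,
    Finset.sum_eq_zero fun j _ => ?_]
  · simp
  · rw [derivative_X_pow]
    simp [hq]

end TracePoly

/-- The properties of the constant field on which the tower depends: `q` is a power of the
characteristic and all the roots of the trace polynomial lie in `K`. -/
structure HasTraceKernel (K : Type*) [Field K] (p q n : ℕ) : Prop where
  prime : p.Prime
  charP : CharP K p
  exists_eq_pow : ∃ e, q = p ^ e
  one_lt : 1 < q
  pos : 0 < n
  splits : (tracePoly K q n).Splits

namespace HasTraceKernel

variable {K : Type*} [Field K] {p q n : ℕ} (h : HasTraceKernel K p q n)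
  {E : Type*} [Field E] [Algebra K E]

include h

theorem cast_eq_zero : (q : K) = 0 := by
  obtain ⟨e, rfl⟩ := h.exists_eq_pow
  have := h.charP
  have he : e ≠ 0 := by rintro rfl; simpa using h.one_lt
  simp [he]

theorem cast_eq_zero' (R : Type*) [CommRing R] [Algebra K R] : (q : R) = 0 := by
  rw [← map_natCast (algebraMap K R), h.cast_eq_zero, map_zero]

theorem traceSum_add (x y : E) : traceSum q n (x + y) = traceSum q n x + traceSum q n y := by
  obtain ⟨e, rfl⟩ := h.exists_eq_pow
  have := h.charP
  have := Fact.mk h.prime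
  have : CharP E p := charP_of_injective_algebraMap (algebraMap K E).injective p
  simp only [traceSum, ← pow_mul, add_pow_char_pow, Finset.sum_add_distrib]

theorem traceSum_sub (x y : E) : traceSum q n (x - y) = traceSum q n x - traceSum q n y := by
  rw [eq_sub_iff_add_eq, ← h.traceSum_add, sub_add_cancel]

/-- The elements of `K` of trace zero, that is, the roots of the trace polynomial. -/
noncomputable def ker (_h : HasTraceKernel K p q n) : Finset K :=
  letI := Classical.decEq K
  (tracePoly K q n).roots.toFinset

theorem monic : (tracePoly K q n).Monic := by
  simpa using monic_tracePoly_sub_C h.one_lt h.pos (0 : K)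

theorem separable (z : E) : (tracePoly E q n - C z).Separable := by
  rw [separable_def, derivative_sub, derivative_tracePoly (h.cast_eq_zero' E) h.pos, derivative_C,
    sub_zero]
  exact isCoprime_one_right

theorem tracePoly_eq_prod : tracePoly K q n = ∏ a ∈ h.ker, (X - C a) := by
  classical
  conv_lhs => rw [h.splits.eq_prod_roots_of_monic h.monic]
  rw [ker, Finset.prod, Multiset.toFinset_val, Multiset.dedup_eq_self.2]
  refine nodup_roots ?_
  simpa using h.separable (0 : K)

theorem traceSum_eq_prod (y : E) : traceSum q n y = ∏ a ∈ h.ker, (y - algebraMap K E a) := by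
  rw [← eval_tracePoly, ← map_tracePoly (algebraMap K E), h.tracePoly_eq_prod, Polynomial.map_prod,
    eval_prod]
  simp

theorem exists_of_traceSum_eq {x y : E} (hxy : traceSum q n x = traceSum q n y) :
    ∃ a : K, x - y = algebraMap K E a := by
  have h0 : traceSum q n (x - y) = 0 := by rw [h.traceSum_sub, hxy, sub_self]
  rw [h.traceSum_eq_prod, Finset.prod_eq_zero_iff] at h0
  obtain ⟨a, -, h0⟩ := h0
  exact ⟨a, sub_eq_zero.1 h0⟩

theorem splits_sub_C (ξ : E) : (tracePoly E q n - C (traceSum q n ξ)).Splits := by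
  have : tracePoly E q n - C (traceSum q n ξ) = (tracePoly E q n).comp (X - C ξ) := by
    obtain ⟨e, rfl⟩ := h.exists_eq_pow
    have := h.charP
    have := Fact.mk h.prime
    have : CharP E p := charP_of_injective_algebraMap (algebraMap K E).injective p
    simp only [tracePoly, traceSum, ← pow_mul, sum_comp, pow_comp, X_comp,
      sub_pow_char_pow, Finset.sum_sub_distrib, map_sum, map_pow]
  rw [this]
  refine Splits.comp_of_natDegree_le_one ?_ (by simp)
  rw [← map_tracePoly (algebraMap K E)]
  exact h.splits.map _

end HasTraceKernel

theorem traceSum_eq_trace {k K : Type*} [Field k] [Field K] [Finite k] [Finite K] [Algebra k K]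
    {q n : ℕ} (hk : Nat.card k = q) (hK : Nat.card K = q ^ n) (c : K) :
    traceSum q n c = algebraMap k K (Algebra.trace k K c) := by
  have hq : 1 < q := hk ▸ Finite.one_lt_card
  have hrank : Module.finrank k K = n := by
    have := Module.natCard_eq_pow_finrank (K := k) (V := K)
    rw [hk, hK] at this
    exact (Nat.pow_right_injective hq this).symm
  rw [FiniteField.algebraMap_trace_eq_sum_pow, hrank, hk, traceSum]

theorem exists_traceSum_eq {k K : Type*} [Field k] [Field K] [Finite k] [Finite K] [Algebra k K]
    {q n : ℕ} (hk : Nat.card k = q) (hK : Nat.card K = q ^ n) (d : k) :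
    ∃ c : K, traceSum q n c = algebraMap k K d := by
  obtain ⟨c, rfl⟩ := Algebra.trace_surjective k K d
  exact ⟨c, traceSum_eq_trace hk hK c⟩

theorem hasTraceKernel_of_card {k K : Type*} [Field k] [Field K] [Finite k] [Finite K]
    [Algebra k K] {p q n : ℕ} [Fact p.Prime] [CharP k p] (hn : 0 < n)
    (hk : Nat.card k = q) (hK : Nat.card K = q ^ n) : HasTraceKernel K p q n where
  prime := Fact.out
  charP := charP_of_injective_algebraMap (algebraMap k K).injective p
  exists_eq_pow := by
    have := Fintype.ofFinite k
    obtain ⟨e, -, he⟩ := FiniteField.card k p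
    exact ⟨e, by rw [← hk, Nat.card_eq_fintype_card, he]⟩
  one_lt := hk ▸ Finite.one_lt_card
  pos := hn
  splits := by
    have hq : 1 < q := hk ▸ Finite.one_lt_card
    have := Fintype.ofFinite K
    -- the trace `S` divides `S ^ q - S = X ^ (q ^ n) - X`
    have hsplit : (X ^ Fintype.card K - X : K[X]).Splits := by
      rw [splits_iff_card_roots, FiniteField.roots_X_pow_card_sub_X, ← Finset.card_def,
        Finset.card_univ, FiniteField.X_pow_card_sub_X_natDegree_eq _ Fintype.one_lt_card]
    refine hsplit.of_dvd (FiniteField.X_pow_card_sub_X_ne_zero K Fintype.one_lt_card) ?_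
    rw [← Nat.card_eq_fintype_card, hK]
    have hpow : (tracePoly K q n) ^ q = ∑ j ∈ Finset.range n, X ^ q ^ (j + 1) := by
      have := Fintype.ofFinite k
      obtain ⟨e, -, he⟩ := FiniteField.card k p
      have : CharP K p := charP_of_injective_algebraMap (algebraMap k K).injective p
      rw [← hk, Nat.card_eq_fintype_card, he, tracePoly, sum_pow_char_pow]
      simp only [← pow_mul, pow_add, pow_one]
    have : (X ^ q ^ n - X : K[X]) = tracePoly K q n ^ q - tracePoly K q n := by
      rw [hpow, tracePoly, ← Finset.sum_sub_distrib, Finset.sum_range_sub (fun j => X ^ q ^ j)]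
      simp
    rw [this]
    exact dvd_sub (dvd_pow_self _ (by omega)) dvd_rfl

end FunctionFieldTower

/-! ### Extensions generated by solutions of trace equations -/

namespace FunctionFieldTower

open Polynomial IntermediateField
open scoped Pointwise

section

variable {F E : Type*} [Field F] [Field E] [Algebra F E]

theorem minpoly_dvd_tracePoly_sub_C {q n : ℕ} {x : E} {z : F}
    (hx : traceSum q n x = algebraMap F E z) :
    minpoly F x ∣ tracePoly F q n - C z := by
  refine minpoly.dvd F x ?_
  rw [map_sub, aeval_C, ← hx, aeval_def, ← eval_map, map_tracePoly, eval_tracePoly, sub_self]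

theorem algEquiv_ext {X : Set E} (hX : adjoin F X = ⊤) {σ τ : Gal(E/F)}
    (hστ : ∀ x ∈ X, σ x = τ x) : σ = τ := by
  have : (σ : E →ₐ[F] E).comp (adjoin F X).val = (τ : E →ₐ[F] E).comp (adjoin F X).val :=
    adjoin_algHom_ext F fun x hx => hστ x hx
  exact AlgEquiv.ext fun y => DFunLike.congr_fun this ⟨y, hX ▸ mem_top⟩

theorem eq_zero_of_algebraMap_mem_nonunits {K : Type*} [Field K] [Algebra K E]
    {V : ValuationSubring E}
    (hV : ∀ a : K, algebraMap K E a ∈ V) {a : K} (ha : algebraMap K E a ∈ V.nonunits) : a = 0 := by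
  rw [V.mem_nonunits_iff_or, ← map_inv₀] at ha
  simpa only [hV, not_true_eq_false, or_false, map_eq_zero] using ha

end

namespace HasTraceKernel

variable {K : Type*} [Field K] {p q n : ℕ} {F E : Type*} [Field F] [Field E] [Algebra F E]

theorem isIntegral_of_traceSum_eq (h : HasTraceKernel K p q n) {x : E} {z : F}
    (hx : traceSum q n x = algebraMap F E z) :
    IsIntegral F x := by
  refine ⟨tracePoly F q n - C z, monic_tracePoly_sub_C h.one_lt h.pos z, ?_⟩
  rw [eval₂_sub, eval₂_C, ← hx, ← eval_map, map_tracePoly, eval_tracePoly, sub_self]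

theorem splits_minpoly (h : HasTraceKernel K p q n) {M : Type*} [Field M] [Algebra K M]
    [Algebra F M] {x : E} {z : F} {ξ : M}
    (hx : traceSum q n x = algebraMap F E z) (hξ : traceSum q n ξ = algebraMap F M z) :
    ((minpoly F x).map (algebraMap F M)).Splits := by
  have hs := h.splits_sub_C ξ
  have hmap : (tracePoly F q n - C z).map (algebraMap F M) =
      tracePoly M q n - C (traceSum q n ξ) := by
    rw [Polynomial.map_sub, map_tracePoly, map_C, hξ]
  rw [← hmap] at hs
  exact hs.of_dvd
    ((monic_tracePoly_sub_C h.one_lt h.pos z).map _).ne_zero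
    (Polynomial.map_dvd _ (minpoly_dvd_tracePoly_sub_C hx))

theorem finiteDimensional (h : HasTraceKernel K p q n) {X : Set E} (hfin : X.Finite)
    (hX : adjoin F X = ⊤)
    (hXz : ∀ x ∈ X, ∃ z : F, traceSum q n x = algebraMap F E z) : FiniteDimensional F E := by
  have := hfin.to_subtype
  have : FiniteDimensional F (adjoin F X) := finiteDimensional_adjoin fun x hx => by
    obtain ⟨z, hz⟩ := hXz x hx
    exact h.isIntegral_of_traceSum_eq hz
  rw [hX] at this
  exact topEquiv.toLinearEquiv.finiteDimensional

theorem mem_of_traceSum_mem (h : HasTraceKernel K p q n) {V : ValuationSubring E} {x : E}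
    (hx : traceSum q n x ∈ V) : x ∈ V := by
  have hint : IsIntegral V x := by
    refine ⟨tracePoly V q n - C ⟨_, hx⟩, monic_tracePoly_sub_C h.one_lt h.pos _, ?_⟩
    rw [eval₂_sub, eval₂_C, ← eval_map, map_tracePoly, eval_tracePoly]
    exact sub_self _
  obtain ⟨y, hy⟩ := IsIntegrallyClosed.isIntegral_iff.1 hint
  exact hy ▸ y.2

variable [Algebra K E]

/-- If `S(x)` has the residue `S(c)`, then `x - c` has the residue of an element of trace zero. -/
theorem exists_sub_mem_nonunits (h : HasTraceKernel K p q n) {V : ValuationSubring E} {x : E}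
    {c : K} (hx : traceSum q n x - algebraMap K E (traceSum q n c) ∈ V.nonunits) :
    ∃ c : K, x - algebraMap K E c ∈ V.nonunits := by
  rw [map_traceSum, ← h.traceSum_sub, h.traceSum_eq_prod] at hx
  obtain ⟨a, -, ha⟩ := exists_of_prod_mem_nonunits hx
  exact ⟨c + a, by rwa [map_add, ← sub_sub]⟩

theorem exists_algEquiv_sub_eq (h : HasTraceKernel K p q n) {x : E} {z : F}
    (hx : traceSum q n x = algebraMap F E z)
    (σ : Gal(E/F)) : ∃ a : K, σ x - x = algebraMap K E a := by
  refine h.exists_of_traceSum_eq ?_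
  have := map_traceSum (σ : E →+* E) q n x
  simp only [hx, RingHom.coe_coe, AlgEquiv.commutes] at this
  rw [hx]; exact this.symm

variable [Algebra K F]

theorem isGalois (h : HasTraceKernel K p q n) {X : Set E} (hX : adjoin F X = ⊤)
    (hXz : ∀ x ∈ X, ∃ z : F, traceSum q n x = algebraMap F E z) : IsGalois F E := by
  have hint : ∀ x ∈ X, IsIntegral F x := fun x hx => by
    obtain ⟨z, hz⟩ := hXz x hx
    exact h.isIntegral_of_traceSum_eq hz
  have hsep : Algebra.IsSeparable F E := by
    have : Algebra.IsSeparable F (adjoin F X) :=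
      (isSeparable_adjoin_iff_isSeparable F E).2 fun x hx => by
      obtain ⟨z, hz⟩ := hXz x hx
      exact (h.separable z).of_dvd (minpoly_dvd_tracePoly_sub_C hz)
    rw [hX] at this
    exact AlgEquiv.Algebra.isSeparable topEquiv
  have hnorm : Normal F E := by
    refine normal_iff.2 fun y => ⟨Algebra.IsSeparable.isIntegral F y, ?_⟩
    refine splits_of_mem_adjoin F E (S := X) (fun x hx => ⟨hint x hx, ?_⟩) (hX ▸ mem_top)
    obtain ⟨z, hz⟩ := hXz x hx
    exact h.splits_minpoly hz hz
  exact { }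

variable [IsScalarTower K F E]

theorem isAbelianGalois (h : HasTraceKernel K p q n) {X : Set E} (hX : adjoin F X = ⊤)
    (hXz : ∀ x ∈ X, ∃ z : F, traceSum q n x = algebraMap F E z) : IsAbelianGalois F E := by
  have := h.isGalois hX hXz
  have hcomm : ∀ σ τ : Gal(E/F), σ * τ = τ * σ := by
    intro σ τ
    refine algEquiv_ext hX fun x hx => ?_
    obtain ⟨z, hz⟩ := hXz x hx
    obtain ⟨a, ha⟩ := h.exists_algEquiv_sub_eq hz σ
    obtain ⟨b, hb⟩ := h.exists_algEquiv_sub_eq hz τ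
    rw [sub_eq_iff_eq_add] at ha hb
    have hK : ∀ (ρ : Gal(E/F)) (c : K), ρ (algebraMap K E c) = algebraMap K E c := fun ρ c => by
      rw [IsScalarTower.algebraMap_apply K F E, AlgEquiv.commutes]
    rw [AlgEquiv.mul_apply, AlgEquiv.mul_apply, ha, hb, map_add, map_add, ha, hb, hK, hK]
    ring
  exact { is_comm := ⟨hcomm⟩ }

/-- If every element of `X` has its residues in `K`, at all the places above `O`, then `O` splits
completely: a place is moved by every automorphism that translates some element of `X` by a non-zero
constant. -/
theorem encard_comap_eq (h : HasTraceKernel K p q n) {X : Set E} (hfin : X.Finite)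
    (hX : adjoin F X = ⊤)
    (hXz : ∀ x ∈ X, ∃ z : F, traceSum q n x = algebraMap F E z) {O : ValuationSubring F}
    (hO : ∀ a : K, algebraMap K F a ∈ O)
    (hres : ∀ V : ValuationSubring E, V.comap (algebraMap F E) = O → ∀ x ∈ X,
      ∃ c : K, x - algebraMap K E c ∈ V.nonunits) :
    {V : ValuationSubring E | V.comap (algebraMap F E) = O}.encard = Module.finrank F E := by
  have := h.finiteDimensional hfin hX hXz
  have := h.isGalois hX hXz
  refine FunctionFieldTower.encard_comap_eq fun V hV σ hσ => algEquiv_ext hX fun x hx => ?_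
  obtain ⟨z, hz⟩ := hXz x hx
  obtain ⟨a, ha⟩ := h.exists_algEquiv_sub_eq hz σ
  obtain ⟨c, hc⟩ := hres V hV x hx
  have hKV : ∀ b : K, algebraMap K E b ∈ V := fun b => by
    rw [IsScalarTower.algebraMap_apply K F E, ← ValuationSubring.mem_comap, hV]
    exact hO b
  have hc' : σ x - algebraMap K E c ∈ V.nonunits := by
    rw [← hσ, mem_nonunits_smul_iff, map_sub, IsScalarTower.algebraMap_apply K F E,
      AlgEquiv.commutes, ← IsScalarTower.algebraMap_apply K F E]
    simpa using hc
  have hmem : algebraMap K E a ∈ V.nonunits := by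
    rw [← ha, ← sub_sub_sub_cancel_right _ _ (algebraMap K E c)]
    exact sub_mem hc' hc
  rw [eq_zero_of_algebraMap_mem_nonunits hKV hmem, map_zero, sub_eq_zero] at ha
  exact ha

/-- If `S(x) ∈ O`, the maximal ideal of `O` generates the maximal ideal of every valuation ring of
`F(x)` above `O`: the conjugates of `x` differ by non-zero constants. -/
theorem exists_eq_sum_mul (h : HasTraceKernel K p q n) {x : E} (hX : adjoin F {x} = ⊤)
    {O : ValuationSubring F}
    (hO : ∀ a : K, algebraMap K F a ∈ O) {z : F} (hz : z ∈ O)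
    (hx : traceSum q n x = algebraMap F E z) {V : ValuationSubring E}
    (hV : V.comap (algebraMap F E) = O) {y : E} (hy : y ∈ V.nonunits) :
    ∃ (N : ℕ) (a : ℕ → F) (w : ℕ → E), (∀ i, a i ∈ O.nonunits) ∧ (∀ i, w i ∈ V) ∧
      y = ∑ i ∈ Finset.range N, algebraMap F E (a i) * w i := by
  have hXz : ∀ y ∈ ({x} : Set E), ∃ z : F, traceSum q n y = algebraMap F E z := by
    rintro y rfl; exact ⟨z, hx⟩
  have := h.finiteDimensional (Set.finite_singleton x) hX hXz
  have := h.isGalois hX hXz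
  have hne : ∀ σ : Gal(E/F), σ ≠ 1 → σ x ≠ x := fun σ hσ hσx =>
    hσ (algEquiv_ext hX (by rintro y rfl; exact hσx))
  refine exists_eq_sum_mul_of_mem_nonunits hV ?_ hne ?_ hy
  · rw [mem_holomorphyRing]
    exact fun W hW => h.mem_of_traceSum_mem (hx ▸ hW hz)
  · intro σ _
    obtain ⟨a, ha⟩ := h.exists_algEquiv_sub_eq hx σ
    rw [← neg_sub, ha, ← map_neg, ← map_inv₀, mem_holomorphyRing]
    intro W hW
    rw [IsScalarTower.algebraMap_apply K F E]
    exact hW (hO _)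

end HasTraceKernel
end FunctionFieldTower

/-! ### Power series solutions of the recursion -/

namespace FunctionFieldTower

open Polynomial IntermediateField

/-- The map `z ↦ 1 / (z ^ 2 - b)`, which sends the trace of `x_i` to that of `x_{i+1}`. -/
def towerStep {E : Type*} [Field E] (b z : E) : E := 1 / (z ^ 2 - b)

theorem map_iterate_towerStep {E M : Type*} [Field E] [Field M] (f : E →+* M) (b z : E) (m : ℕ) :
    f ((towerStep b)^[m] z) = (towerStep (f b))^[m] (f z) := by
  induction m with
  | zero => rfl
  | succ m ih => simp [Function.iterate_succ_apply', towerStep, ih]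

section PowerSeries

variable {K Ω : Type*} [Field K] [Field Ω] [Algebra K Ω]

theorem powerSeries_eq_zero_of_isAlgebraic {f : PowerSeries Ω} (hf : IsAlgebraic K f)
    (h0 : PowerSeries.constantCoeff f = 0) : f = 0 := by
  by_contra hne
  obtain ⟨r, hr0, hr⟩ := hf.exists_nonzero_coeff_and_aeval_eq_zero
    (mem_nonZeroDivisors_of_ne_zero hne)
  refine hr0 ((algebraMap K Ω).injective ?_)
  have h1 : PowerSeries.constantCoeff (aeval f r) = algebraMap K Ω (r.coeff 0) := by
    rw [aeval_def, hom_eval₂, h0, eval₂_at_zero]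
    simp [PowerSeries.algebraMap_apply]
  rw [map_zero, ← h1, hr, map_zero]

theorem transcendental_C_add_X [Algebra.IsAlgebraic K Ω] (c : Ω) :
    Transcendental K (PowerSeries.C c + PowerSeries.X : PowerSeries Ω) := by
  intro halg
  have hc : IsAlgebraic K (PowerSeries.C c : PowerSeries Ω) := by
    have := (Algebra.IsAlgebraic.isAlgebraic (R := K) c).algHom
      (IsScalarTower.toAlgHom K Ω (PowerSeries Ω))
    exact this
  have hX : IsAlgebraic K (PowerSeries.X : PowerSeries Ω) := by
    simpa using halg.sub hc
  exact PowerSeries.X_ne_zero (powerSeries_eq_zero_of_isAlgebraic hX (by simp))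

/-- Hensel's lemma: the trace equation is solvable in power series if it is solvable modulo `X`. -/
theorem HasTraceKernel.exists_powerSeries {p q n : ℕ} (h : HasTraceKernel K p q n)
    {ζ : PowerSeries Ω} {c : Ω} (hc : traceSum q n c = PowerSeries.constantCoeff ζ) :
    ∃ ξ : PowerSeries Ω, (tracePoly (PowerSeries Ω) q n).eval ξ = ζ := by
  have hH : HenselianRing (PowerSeries Ω) (Ideal.span {PowerSeries.X}) := inferInstance
  obtain ⟨ξ, hξ, -⟩ := hH.is_henselian (tracePoly (PowerSeries Ω) q n - C ζ)
    (monic_tracePoly_sub_C h.one_lt h.pos ζ) (PowerSeries.C c) (by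
      rw [Ideal.mem_span_singleton, PowerSeries.X_dvd_iff, eval_sub, eval_C, map_sub, ← hc,
        map_eval_tracePoly, PowerSeries.constantCoeff_C, eval_tracePoly, sub_self]) (by
      rw [derivative_sub, derivative_C, sub_zero,
        derivative_tracePoly (h.cast_eq_zero' (PowerSeries Ω)) h.pos]
      simp)
  refine ⟨ξ, ?_⟩
  simpa [sub_eq_zero] using hξ

/-- The power series of the traces `z_1, z_2, …` when `z_1` has the constant term `b 0` and a
non-zero linear term. The constant terms are the prescribed orbit `b`, and the linear term never
vanishes as long as the orbit does not meet the critical point `0` of the recursion. -/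
theorem exists_powerSeries_iterate {M : Type*} [Field M] [Algebra (PowerSeries Ω) M]
    (h2 : (2 : Ω) ≠ 0) {β : Ω} {b : ℕ → Ω} {N : ℕ}
    (hb : ∀ m < N, b (m + 1) * (b m ^ 2 - β) = 1) {ζ : PowerSeries Ω}
    (hζ₀ : PowerSeries.constantCoeff ζ = b 0) (hζ₁ : PowerSeries.coeff 1 ζ ≠ 0) :
    ∀ m ≤ N, ∃ ψ : PowerSeries Ω,
      algebraMap (PowerSeries Ω) M ψ =
        (towerStep (algebraMap (PowerSeries Ω) M (PowerSeries.C β)))^[m]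
          (algebraMap (PowerSeries Ω) M ζ) ∧
      PowerSeries.constantCoeff ψ = b m ∧
      ((∀ l < m, b l ≠ 0) → PowerSeries.coeff 1 ψ ≠ 0) := by
  intro m
  induction m with
  | zero => exact fun _ => ⟨ζ, rfl, hζ₀, fun _ => hζ₁⟩
  | succ m ih =>
    intro hm
    obtain ⟨ψ, hψ, hψ0, hψ1⟩ := ih (by omega)
    have hbm := hb m (by omega)
    set η : PowerSeries Ω := ψ ^ 2 - PowerSeries.C β with hη
    have hη0 : PowerSeries.constantCoeff η = b m ^ 2 - β := by simp [hη, hψ0]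
    have hne : PowerSeries.constantCoeff η ≠ 0 := by
      rw [hη0]; rintro h0; simp [h0] at hbm
    have hmul : η * η⁻¹ = 1 := PowerSeries.mul_inv_cancel η hne
    have hinv : PowerSeries.constantCoeff η⁻¹ = b (m + 1) := by
      rw [PowerSeries.constantCoeff_inv, hη0]
      exact (eq_inv_of_mul_eq_one_left hbm).symm
    refine ⟨η⁻¹, ?_, hinv, fun hbl => ?_⟩
    · rw [Function.iterate_succ_apply', ← hψ, towerStep, ← map_pow, ← map_sub, one_div]
      exact (eq_inv_of_mul_eq_one_right (by rw [← map_mul, hmul, map_one]))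
    · intro h0
      have hcoeff := congrArg (PowerSeries.coeff 1) hmul
      have hη1 : PowerSeries.coeff 1 η = 2 * b m * PowerSeries.coeff 1 ψ := by
        rw [hη, pow_two, map_sub, PowerSeries.coeff_one_mul, hψ0, PowerSeries.coeff_C]
        simp; ring
      rw [PowerSeries.coeff_one_mul, h0, hinv, hη1, PowerSeries.coeff_one] at hcoeff
      have hb1 : b (m + 1) ≠ 0 := by rintro h0; simp [h0] at hbm
      have hbm0 : b m ≠ 0 := hbl m (by omega)
      have := hψ1 fun l hl => hbl l (by omega)
      simp [hb1, hbm0, h2, this] at hcoeff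

/-- The polynomial `X ^ (q ^ (n - 1)) - w * ∑ X ^ (q ^ (n - 1) - q ^ j)`, whose roots are the
inverses of the solutions of the trace equation with right-hand side `w⁻¹`. -/
noncomputable def reversedPoly {R : Type*} [CommRing R] (q n : ℕ) (w : R) : R[X] :=
  X ^ q ^ (n - 1) - C w * ∑ j ∈ Finset.range n, X ^ (q ^ (n - 1) - q ^ j)

theorem map_reversedPoly {R S : Type*} [CommRing R] [CommRing S] (f : R →+* S) (q n : ℕ) (w : R) :
    (reversedPoly q n w).map f = reversedPoly q n (f w) := by
  simp [reversedPoly, Polynomial.map_sum]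

theorem degree_reversedPoly_tail_lt {R : Type*} [CommRing R] [Nontrivial R] {q n : ℕ}
    (hq : 1 < q) (w : R) :
    (C w * ∑ j ∈ Finset.range n, (X : R[X]) ^ (q ^ (n - 1) - q ^ j)).degree <
      (q ^ (n - 1) : ℕ) := by
  rw [← smul_eq_C_mul]
  refine (degree_smul_le _ _).trans_lt ?_
  refine (degree_sum_le _ _).trans_lt ((Finset.sup_lt_iff (WithBot.bot_lt_coe _)).2 fun j hj => ?_)
  rw [degree_X_pow]
  have h1 : 0 < q ^ j := pow_pos (by omega) j
  have h2 : 0 < q ^ (n - 1) := pow_pos (by omega) _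
  exact_mod_cast (by omega : q ^ (n - 1) - q ^ j < q ^ (n - 1))

theorem monic_reversedPoly {R : Type*} [CommRing R] {q n : ℕ} (hq : 1 < q) (w : R) :
    (reversedPoly q n w).Monic := by
  nontriviality R
  rw [reversedPoly, sub_eq_add_neg]
  exact monic_X_pow_add (by rw [degree_neg]; exact degree_reversedPoly_tail_lt hq w)

theorem natDegree_reversedPoly {R : Type*} [CommRing R] [Nontrivial R] {q n : ℕ} (hq : 1 < q)
    (w : R) : (reversedPoly q n w).natDegree = q ^ (n - 1) := by
  refine natDegree_eq_of_degree_eq_some ?_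
  rw [reversedPoly, degree_sub_eq_left_of_degree_lt, degree_X_pow]
  rw [degree_X_pow]
  exact degree_reversedPoly_tail_lt hq w

/-- Eisenstein's criterion for a power series `w` of order one. -/
theorem irreducible_reversedPoly {q n : ℕ} (hq : 1 < q) (hn : 0 < n) {w : PowerSeries Ω}
    (hw₀ : PowerSeries.constantCoeff w = 0) (hw₁ : PowerSeries.coeff 1 w ≠ 0) :
    Irreducible (reversedPoly q n w) := by
  have hmonic := monic_reversedPoly (n := n) hq w
  have hdeg := natDegree_reversedPoly (n := n) hq w
  have hprime : (Ideal.span {(PowerSeries.X : PowerSeries Ω)}).IsPrime :=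
    PowerSeries.span_X_isPrime
  have hDpos : 0 < q ^ (n - 1) := pow_pos (by omega) _
  refine irreducible_of_eisenstein_criterion hprime ?_ ?_ ?_ ?_ hmonic.isPrimitive
  · rw [hmonic.leadingCoeff, ← Ideal.eq_top_iff_one]
    exact hprime.ne_top
  · intro m hm
    rw [degree_eq_natDegree hmonic.ne_zero, hdeg] at hm
    have hm' : m < q ^ (n - 1) := by exact_mod_cast hm
    rw [reversedPoly, coeff_sub, coeff_X_pow, if_neg hm'.ne, zero_sub, coeff_C_mul, neg_mem_iff]
    exact Ideal.mul_mem_right _ _ (Ideal.mem_span_singleton.2 (PowerSeries.X_dvd_iff.2 hw₀))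
  · rw [degree_eq_natDegree hmonic.ne_zero, hdeg]
    exact_mod_cast hDpos
  · have hsum : (∑ j ∈ Finset.range n,
        (X : (PowerSeries Ω)[X]) ^ (q ^ (n - 1) - q ^ j)).coeff 0 = 1 := by
      rw [finsetSum_coeff, Finset.sum_eq_single (n - 1)]
      · simp
      · intro j hj hjn
        have hlt : q ^ j < q ^ (n - 1) :=
          Nat.pow_lt_pow_right hq (by have := Finset.mem_range.1 hj; omega)
        rw [coeff_X_pow, if_neg (by omega)]
      · intro hcon; exact absurd (Finset.mem_range.2 (by omega)) hcon
    rw [reversedPoly, coeff_sub, coeff_X_pow, if_neg hDpos.ne, zero_sub, coeff_C_mul, hsum, mul_one,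
      neg_mem_iff, Ideal.span_singleton_pow, Ideal.mem_span_singleton, PowerSeries.X_pow_dvd_iff]
    exact fun hcon => hw₁ (hcon 1 (by omega))

end PowerSeries

end FunctionFieldTower

/-! ### The fields of the tower and their embeddings -/

namespace FunctionFieldTower

open Polynomial IntermediateField

section Tower

variable {K L : Type*} [Field K] [Field L] [Algebra K L] {x : ℕ → L} {β : K} {p q n : ℕ}

theorem mem_towerField {l i : ℕ} (hl : 1 ≤ l) (hli : l ≤ i) : x l ∈ towerField K x i :=
  subset_adjoin K _ ⟨l, ⟨hl, hli⟩, rfl⟩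

theorem traceSum_add_eq_iterate
    (hx : ∀ i, 1 ≤ i → traceSum q n (x (i + 1)) = towerStep (algebraMap K L β) (traceSum q n (x i)))
    {i : ℕ} (hi : 1 ≤ i) (m : ℕ) :
    traceSum q n (x (i + m)) = (towerStep (algebraMap K L β))^[m] (traceSum q n (x i)) := by
  induction m with
  | zero => rfl
  | succ m ih => rw [← add_assoc, hx _ (by omega), ih, Function.iterate_succ_apply']

theorem extendScalars_towerField {i j : ℕ} (hij : i ≤ j) :
    extendScalars (towerField_mono K x hij) =
      adjoin (towerField K x i) (x '' Set.Icc (i + 1) j) := by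
  refine le_antisymm ?_ (adjoin_le_iff.2 ?_)
  · rw [extendScalars_le_iff]
    refine adjoin_le_iff.2 ?_
    rintro _ ⟨l, ⟨hl1, hlj⟩, rfl⟩
    rw [SetLike.mem_coe, mem_restrictScalars]
    by_cases hl : l ≤ i
    · have hmem : x l ∈ towerField K x i := mem_towerField hl1 hl
      exact (adjoin (towerField K x i) (x '' Set.Icc (i + 1) j)).algebraMap_mem
        (⟨x l, hmem⟩ : towerField K x i)
    · exact subset_adjoin _ _ ⟨l, ⟨by omega, hlj⟩, rfl⟩
  · rintro _ ⟨l, ⟨hl1, hlj⟩, rfl⟩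
    exact mem_towerField (K := K) (x := x) (by omega) hlj

theorem adjoin_preimage_eq_top {F : Type*} [Field F] [Algebra F L] {M : IntermediateField F L}
    {X : Set L} (hM : M = adjoin F X) : adjoin F ((↑) ⁻¹' X : Set M) = ⊤ := by
  apply lift_injective
  rw [lift_adjoin, lift_top, Set.image_preimage_eq_of_subset, ← hM]
  rw [Subtype.range_coe, hM]
  exact subset_adjoin F X

/-- The generators `x_{i+1}, …, x_j` of `T_j` over `T_i`. -/
def stepGenerators (K : Type*) {L : Type*} [Field K] [Field L] [Algebra K L] (x : ℕ → L) {i j : ℕ}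
    (hij : i ≤ j) : Set (extendScalars (towerField_mono K x hij)) :=
  (↑) ⁻¹' (x '' Set.Icc (i + 1) j)

theorem finite_stepGenerators {i j : ℕ} (hij : i ≤ j) : (stepGenerators K x hij).Finite :=
  ((Set.finite_Icc _ _).image x).preimage Subtype.val_injective.injOn

theorem adjoin_stepGenerators {i j : ℕ} (hij : i ≤ j) :
    adjoin (towerField K x i) (stepGenerators K x hij) = ⊤ :=
  adjoin_preimage_eq_top (extendScalars_towerField hij)

theorem traceSum_stepGenerators
    (hx : ∀ i, 1 ≤ i → traceSum q n (x (i + 1)) = towerStep (algebraMap K L β) (traceSum q n (x i)))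
    {i j : ℕ} (hi : 1 ≤ i) (hij : i ≤ j) :
    ∀ y ∈ stepGenerators K x hij, ∃ m, traceSum q n y =
      algebraMap (towerField K x i) (extendScalars (towerField_mono K x hij))
        ((towerStep (algebraMap K _ β))^[m + 1]
          (traceSum q n ⟨x i, mem_towerField hi le_rfl⟩)) := by
  rintro y ⟨l, ⟨hl1, hlj⟩, hly⟩
  obtain ⟨m, rfl⟩ : ∃ m, l = i + (m + 1) := ⟨l - i - 1, by omega⟩
  refine ⟨m, ?_⟩
  apply (algebraMap (extendScalars (towerField_mono K x hij)) L).injective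
  rw [← IsScalarTower.algebraMap_apply, map_iterate_towerStep, map_traceSum, map_traceSum,
    ← IsScalarTower.algebraMap_apply]
  exact (congrArg _ hly.symm).trans (traceSum_add_eq_iterate hx hi (m + 1))

theorem exists_traceSum_stepGenerators
    (hx : ∀ i, 1 ≤ i → traceSum q n (x (i + 1)) = towerStep (algebraMap K L β) (traceSum q n (x i)))
    {i j : ℕ} (hi : 1 ≤ i) (hij : i ≤ j) :
    ∀ y ∈ stepGenerators K x hij, ∃ z : towerField K x i, traceSum q n y =
      algebraMap (towerField K x i) (extendScalars (towerField_mono K x hij)) z := fun y hy =>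
  let ⟨_, hm⟩ := traceSum_stepGenerators hx hi hij y hy
  ⟨_, hm⟩

theorem exists_algHom_towerField_one {M : Type*} [Field M] [Algebra K M]
    (hx₁ : Transcendental K (x 1)) {ξ : M} (hξ : Transcendental K ξ) :
    ∃ φ : towerField K x 1 →ₐ[K] M, φ ⟨x 1, mem_towerField le_rfl le_rfl⟩ = ξ := by
  have h1 : towerField K x 1 = K⟮x 1⟯ := by simp [towerField]
  let e := (RatFunc.algEquivOfTranscendental (x 1) hx₁).symm.trans
    (RatFunc.algEquivOfTranscendental ξ hξ)
  refine ⟨(K⟮ξ⟯.val.comp e.toAlgHom).comp (inclusion h1.le), ?_⟩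
  have h2 : inclusion h1.le ⟨x 1, mem_towerField le_rfl le_rfl⟩ = AdjoinSimple.gen K (x 1) := rfl
  simp [h2, e, RatFunc.algEquivOfTranscendental_symm_gen]

theorem exists_algHom_comp_inclusion_eq {M : Type*} [Field M] [Algebra K M]
    {F E : IntermediateField K L} (hFE : F ≤ E) (φ : F →ₐ[K] M) {S : Set L}
    (hS : extendScalars hFE = adjoin F S)
    (hs : ∀ s ∈ S, IsIntegral F s ∧ ((minpoly F s).map (φ : F →+* M)).Splits) :
    ∃ Φ : E →ₐ[K] M, Φ.comp (inclusion hFE) = φ := by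
  let := (φ : F →+* M).toAlgebra
  have : IsScalarTower K F M := IsScalarTower.of_algebraMap_eq fun c => (φ.commutes c).symm
  obtain ⟨ψ⟩ := nonempty_algHom_adjoin_of_splits (F := F) (S := S) (K := M) (E := L) hs
  rw [← hS] at ψ
  let ι : E →ₐ[K] extendScalars hFE := { RingHom.id E with commutes' := fun _ => rfl }
  refine ⟨(ψ.restrictScalars K).comp ι, AlgHom.ext fun y => ?_⟩
  exact ψ.commutes y

/-- An embedding of `T_i` is obtained from one of `K(x_1)` if all the trace equations are solvable
in the target. -/
theorem exists_algHom_towerField (h : HasTraceKernel K p q n) (hx₁ : Transcendental K (x 1))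
    (hx : ∀ i, 1 ≤ i → traceSum q n (x (i + 1)) = towerStep (algebraMap K L β) (traceSum q n (x i)))
    {M : Type*} [Field M] [Algebra K M] {ξ : M} (hξ : Transcendental K ξ) {i : ℕ} (hi : 1 ≤ i)
    (hsol : ∀ m < i, ∃ η : M,
      traceSum q n η = (towerStep (algebraMap K M β))^[m] (traceSum q n ξ)) :
    ∃ φ : towerField K x i →ₐ[K] M, φ ⟨x 1, mem_towerField le_rfl hi⟩ = ξ := by
  obtain ⟨φ, hφ⟩ := exists_algHom_towerField_one hx₁ hξ
  obtain ⟨Φ, hΦ⟩ := exists_algHom_comp_inclusion_eq (towerField_mono K x hi) φ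
    (extendScalars_towerField hi) (by
      rintro _ ⟨l, ⟨hl2, hli⟩, rfl⟩
      obtain ⟨m, rfl⟩ : ∃ m, l = 1 + m := ⟨l - 1, by omega⟩
      set z : towerField K x 1 := (towerStep (algebraMap K _ β))^[m]
        (traceSum q n ⟨x 1, mem_towerField le_rfl le_rfl⟩) with hz
      have hxz : traceSum q n (x (1 + m)) = algebraMap (towerField K x 1) L z := by
        rw [traceSum_add_eq_iterate hx le_rfl, hz, map_iterate_towerStep, map_traceSum]
        rfl
      obtain ⟨η, hη⟩ := hsol m (by omega)
      have hηz : traceSum q n η = (φ : towerField K x 1 →+* M) z := by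
        rw [hη, hz, map_iterate_towerStep, map_traceSum, RingHom.coe_coe, φ.commutes, hφ]
      let := (φ : towerField K x 1 →+* M).toAlgebra
      exact ⟨h.isIntegral_of_traceSum_eq hxz, h.splits_minpoly hxz hηz⟩)
  exact ⟨Φ, (DFunLike.congr_fun hΦ ⟨x 1, mem_towerField le_rfl le_rfl⟩).trans hφ⟩

end Tower

end FunctionFieldTower

/-! ### Degrees and the field of constants -/

namespace FunctionFieldTower

open Polynomial IntermediateField

/-- If `S(x) = 1 / w`, the inverse of `x` is a root of `reversedPoly q n w`. -/
theorem finrank_adjoin_simple_of_irreducible {F L : Type*} [Field F] [Field L] [Algebra F L]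
    {q n : ℕ} (hq : 1 < q) {x : L} {w : F} (hw : w ≠ 0)
    (hx : traceSum q n x = 1 / algebraMap F L w) (hirr : Irreducible (reversedPoly q n w)) :
    Module.finrank F F⟮x⟯ = q ^ (n - 1) := by
  have hw' : algebraMap F L w ≠ 0 := (_root_.map_ne_zero _).2 hw
  have hx0 : x ≠ 0 := by
    rintro rfl
    have h0 : traceSum q n (0 : L) = 0 :=
      Finset.sum_eq_zero fun j _ => zero_pow (pow_pos (by omega) j).ne'
    rw [h0, eq_comm, one_div, inv_eq_zero] at hx
    exact hw' hx
  have hroot : aeval x⁻¹ (reversedPoly q n w) = 0 := by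
    have hsum : ∑ j ∈ Finset.range n, x⁻¹ ^ (q ^ (n - 1) - q ^ j) =
        x⁻¹ ^ q ^ (n - 1) * traceSum q n x := by
      rw [traceSum, Finset.mul_sum]
      refine Finset.sum_congr rfl fun j hj => ?_
      have hle : q ^ j ≤ q ^ (n - 1) :=
        Nat.pow_le_pow_right (by omega) (by have := Finset.mem_range.1 hj; omega)
      rw [← Nat.sub_add_cancel hle, pow_add, Nat.add_sub_cancel, mul_assoc, ← mul_pow,
        inv_mul_cancel₀ hx0, one_pow, mul_one]
    simp only [reversedPoly, map_sub, map_mul, map_pow, map_sum, aeval_X, aeval_C]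
    rw [hsum, hx]
    field_simp
    ring
  have hmin := minpoly.eq_of_irreducible_of_monic hirr hroot (monic_reversedPoly hq w)
  have hint : IsIntegral F x⁻¹ := ⟨_, monic_reversedPoly hq w, hroot⟩
  have hinv : F⟮x⟯ = F⟮x⁻¹⟯ := by
    refine le_antisymm (adjoin_simple_le_iff.2 ?_) (adjoin_simple_le_iff.2 ?_)
    · simpa using inv_mem (mem_adjoin_simple_self F x⁻¹)
    · exact inv_mem (mem_adjoin_simple_self F x)
  rw [hinv, adjoin.finrank hint, ← hmin, natDegree_reversedPoly hq w]

/-- A backward orbit of `√α` under `z ↦ 1 / (z ^ 2 - α)`. It avoids `0`, because an orbit through an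
element of `k` stays in `k` and `√α ∉ k`. -/
theorem exists_orbit {k Ω : Type*} [Field k] [Field Ω] [IsAlgClosed Ω] (ι : k →+* Ω) {α : k}
    (hα : ¬ IsSquare α) (N : ℕ) :
    ∃ b : ℕ → Ω, b N ^ 2 = ι α ∧ (∀ m ≤ N, b m ≠ 0) ∧
      ∀ m < N, b (m + 1) * (b m ^ 2 - ι α) = 1 := by
  obtain ⟨r, hr⟩ := IsAlgClosed.exists_pow_nat_eq (ι α) two_pos
  have hsqrt : ∀ y : Ω, ∃ z : Ω, z ^ 2 = ι α + 1 / y := fun y =>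
    IsAlgClosed.exists_pow_nat_eq _ two_pos
  choose g hg using hsqrt
  have hrange : ∀ m, g^[m] r ∉ Set.range ι := by
    intro m
    induction m with
    | zero =>
      rintro ⟨d, hd⟩
      refine hα ⟨d, ι.injective ?_⟩
      rw [map_mul, hd, ← pow_two, Function.iterate_zero_apply, hr]
    | succ m ih =>
      rintro ⟨d, hd⟩
      refine ih ⟨(d ^ 2 - α)⁻¹, ?_⟩
      rw [map_inv₀, map_sub, map_pow, hd, Function.iterate_succ_apply', hg]
      simp
  have hne : ∀ m, g^[m] r ≠ 0 := fun m h0 => hrange m ⟨0, by rw [h0, map_zero]⟩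
  refine ⟨fun m => g^[N - m] r, by simp [hr], fun m _ => hne _, fun m hm => ?_⟩
  obtain ⟨l, hl⟩ : ∃ l, N - m = l + 1 := ⟨N - m - 1, by omega⟩
  have hl' : N - (m + 1) = l := by omega
  simp only [hl, hl', Function.iterate_succ_apply', hg]
  have := hne l
  field_simp
  ring

section Tower

variable {K L : Type*} [Field K] [Field L] [Algebra K L] {x : ℕ → L} {β : K} {p q n : ℕ}

/-- Only the term `X` of the trace polynomial contributes to the linear coefficient. -/
theorem HasTraceKernel.coeff_one_eval {Ω : Type*} [Field Ω] [Algebra K Ω]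
    (h : HasTraceKernel K p q n) (f : PowerSeries Ω) :
    PowerSeries.coeff 1 ((tracePoly (PowerSeries Ω) q n).eval f) = PowerSeries.coeff 1 f := by
  obtain ⟨m, rfl⟩ := Nat.exists_eq_succ_of_ne_zero h.pos.ne'
  rw [tracePoly, eval_finsetSum, map_sum, Finset.sum_range_succ', Finset.sum_eq_zero fun j _ => ?_]
  · simp
  · rw [eval_pow, eval_X, PowerSeries.coeff_one_pow, Nat.cast_pow, h.cast_eq_zero' Ω]
    simp

/-- The expansion of the tower at the point `x_1 = c`, for a prescribed orbit `b` of constant terms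
of the traces. -/
theorem exists_algHom_fractionRing_powerSeries (h : HasTraceKernel K p q n) (h2 : (2 : K) ≠ 0)
    (hx₁ : Transcendental K (x 1))
    (hx : ∀ i, 1 ≤ i → traceSum q n (x (i + 1)) = towerStep (algebraMap K L β) (traceSum q n (x i)))
    {Ω : Type*} [Field Ω] [Algebra K Ω] [Algebra.IsAlgebraic K Ω] {b : ℕ → Ω} {N : ℕ}
    (hb : ∀ m < N, b (m + 1) * (b m ^ 2 - algebraMap K Ω β) = 1)
    (hsol : ∀ m ≤ N, ∃ c : Ω, traceSum q n c = b m) :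
    ∃ (φ : towerField K x (N + 1) →ₐ[K] FractionRing (PowerSeries Ω)) (ψ : PowerSeries Ω),
      φ (traceSum q n ⟨x (N + 1), mem_towerField (by omega) le_rfl⟩) = algebraMap _ _ ψ ∧
      PowerSeries.constantCoeff ψ = b N ∧
      ((∀ l < N, b l ≠ 0) → PowerSeries.coeff 1 ψ ≠ 0) := by
  set M := FractionRing (PowerSeries Ω)
  have h2' : (2 : Ω) ≠ 0 := by
    rw [← map_ofNat (algebraMap K Ω) 2]
    exact (_root_.map_ne_zero _).2 h2
  obtain ⟨c, hc⟩ := hsol 0 (Nat.zero_le _)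
  set ξ : PowerSeries Ω := PowerSeries.C c + PowerSeries.X with hξdef
  set ζ : PowerSeries Ω := (tracePoly (PowerSeries Ω) q n).eval ξ with hζdef
  have hζ₀ : PowerSeries.constantCoeff ζ = b 0 := by
    rw [hζdef, map_eval_tracePoly, eval_tracePoly, ← hc]
    simp [hξdef]
  have hζ₁ : PowerSeries.coeff 1 ζ ≠ 0 := by
    rw [hζdef, h.coeff_one_eval, hξdef, map_add, PowerSeries.coeff_C, PowerSeries.coeff_one_X]
    simp
  have hζM : algebraMap (PowerSeries Ω) M ζ = traceSum q n (algebraMap (PowerSeries Ω) M ξ) :=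
    (map_eval_tracePoly _ q n ξ).trans (eval_tracePoly q n _)
  have hβ : algebraMap (PowerSeries Ω) M (PowerSeries.C (algebraMap K Ω β)) = algebraMap K M β := by
    rw [IsScalarTower.algebraMap_apply K (PowerSeries Ω) M, PowerSeries.algebraMap_apply]
  have hiter := exists_powerSeries_iterate (M := M) h2' hb hζ₀ hζ₁
  rw [hβ, hζM] at hiter
  have hξ : Transcendental K (algebraMap (PowerSeries Ω) M ξ) :=
    (transcendental_algebraMap_iff (IsFractionRing.injective (PowerSeries Ω) M)).2
      (transcendental_C_add_X c)
  obtain ⟨φ, hφ⟩ := exists_algHom_towerField h hx₁ hx hξ (i := N + 1) (by omega) fun m hm => by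
    obtain ⟨ψ, hψ, hψ0, -⟩ := hiter m (by omega)
    obtain ⟨d, hd⟩ := hsol m (by omega)
    obtain ⟨η, hη⟩ := h.exists_powerSeries (ζ := ψ) (c := d) (by rw [hd, hψ0])
    exact ⟨algebraMap (PowerSeries Ω) M η, by
      rw [← eval_tracePoly, ← map_eval_tracePoly, hη, hψ]⟩
  obtain ⟨ψ, hψ, hψ0, hψ1⟩ := hiter N le_rfl
  refine ⟨φ, ψ, ?_, hψ0, hψ1⟩
  have hN : traceSum q n (⟨x (N + 1), mem_towerField (by omega) le_rfl⟩ : towerField K x (N + 1)) =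
      (towerStep (algebraMap K _ β))^[N]
        (traceSum q n ⟨x 1, mem_towerField le_rfl (by omega)⟩) := by
    apply (algebraMap (towerField K x (N + 1)) L).injective
    rw [map_iterate_towerStep, map_traceSum, map_traceSum]
    have := traceSum_add_eq_iterate hx le_rfl N
    rw [add_comm 1 N] at this
    exact this
  rw [hψ, hN, ← hφ, ← RingHom.coe_coe φ, map_iterate_towerStep, map_traceSum]
  simp

/-- At a point with `z_i = √α`, unramified over the line, `1 / z_{i+1}` has a simple zero; so the
equation of `x_{i+1}` is of Eisenstein type there. -/
theorem finrank_towerField_succ {k : Type*} [Field k] [Algebra k K] {α : k} (hα : ¬ IsSquare α)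
    (h : HasTraceKernel K p q n) (h2 : (2 : K) ≠ 0) (hx₁ : Transcendental K (x 1))
    (hx : ∀ i, 1 ≤ i → traceSum q n (x (i + 1)) =
      towerStep (algebraMap K L (algebraMap k K α)) (traceSum q n (x i)))
    {i : ℕ} (hi : 1 ≤ i) :
    Module.finrank (towerField K x i) (extendScalars (towerField_mono K x (Nat.le_succ i))) =
      q ^ (n - 1) := by
  obtain ⟨N, rfl⟩ : ∃ N, i = N + 1 := ⟨i - 1, by omega⟩
  set β := algebraMap k K α with hβ
  let Ω := AlgebraicClosure K
  obtain ⟨b, hbN, hb0, hb⟩ := exists_orbit ((algebraMap K Ω).comp (algebraMap k K)) hα N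
  obtain ⟨φ, ψ, hφ, hψ0, hψ1⟩ := exists_algHom_fractionRing_powerSeries h h2 hx₁ hx (b := b) hb
    fun m _ => by
      obtain ⟨c, hc⟩ := IsAlgClosed.exists_root (tracePoly Ω q n - C (b m)) (by
        rw [degree_eq_natDegree (monic_tracePoly_sub_C h.one_lt h.pos _).ne_zero,
          natDegree_tracePoly_sub_C h.one_lt h.pos]
        exact_mod_cast (pow_pos (by have := h.one_lt; omega) _).ne')
      refine ⟨c, ?_⟩
      rwa [IsRoot.def, eval_sub, eval_C, eval_tracePoly, sub_eq_zero] at hc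
  set w : PowerSeries Ω := ψ ^ 2 - PowerSeries.C (algebraMap K Ω β) with hw
  have hw₀ : PowerSeries.constantCoeff w = 0 := by
    simp only [hw, map_sub, map_pow, hψ0, hbN, PowerSeries.constantCoeff_C]
    simp [hβ]
  have hw₁ : PowerSeries.coeff 1 w ≠ 0 := by
    have h2' : (2 : Ω) ≠ 0 := by
      rw [← map_ofNat (algebraMap K Ω) 2]
      exact (_root_.map_ne_zero _).2 h2
    have : PowerSeries.coeff 1 w = 2 * b N * PowerSeries.coeff 1 ψ := by
      rw [hw, pow_two, map_sub, PowerSeries.coeff_one_mul, hψ0, PowerSeries.coeff_C]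
      simp; ring
    rw [this]
    exact mul_ne_zero (mul_ne_zero h2' (hb0 N le_rfl)) (hψ1 fun l hl => hb0 l hl.le)
  set z : towerField K x (N + 1) :=
    traceSum q n ⟨x (N + 1), mem_towerField (by omega) le_rfl⟩ with hz
  have hφw : φ (z ^ 2 - algebraMap K _ β) = algebraMap _ _ w := by
    rw [map_sub, map_pow, hφ, φ.commutes, hw, map_sub, map_pow,
      IsScalarTower.algebraMap_apply K (PowerSeries Ω) (FractionRing (PowerSeries Ω)),
      PowerSeries.algebraMap_apply]
  have hirr : Irreducible (reversedPoly q n (z ^ 2 - algebraMap K _ β)) := by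
    have h1 := irreducible_reversedPoly h.one_lt h.pos hw₀ hw₁
    rw [(monic_reversedPoly h.one_lt w).irreducible_iff_irreducible_map_fraction_map
      (K := FractionRing (PowerSeries Ω)), map_reversedPoly, ← hφw,
      ← RingHom.coe_coe φ, ← map_reversedPoly] at h1
    exact (monic_reversedPoly h.one_lt _).irreducible_of_irreducible_map _ _ h1
  have hzw : z ^ 2 - algebraMap K _ β ≠ 0 := by
    intro h0
    rw [h0, map_zero, eq_comm, FaithfulSMul.algebraMap_eq_zero_iff] at hφw
    exact hw₁ (by rw [hφw, map_zero])
  have hset : x '' Set.Icc (N + 1 + 1) (N + 1).succ = {x (N + 1 + 1)} := by simp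
  rw [extendScalars_towerField (Nat.le_succ _), hset]
  refine finrank_adjoin_simple_of_irreducible h.one_lt hzw ?_ hirr
  rw [hx _ (by omega), towerStep, map_sub, map_pow, hz, map_traceSum]
  rfl

/-- Constants of `T_i` are algebraic power series over `K` in the expansion at `x_1 = 0`, and these
are constant. -/
theorem mem_range_algebraMap_of_isAlgebraic {k : Type*} [Field k] [Algebra k K] [Finite k]
    [Finite K] (hk : Nat.card k = q) (hK : Nat.card K = q ^ n) {α : k} (hα : ¬ IsSquare α)
    (h : HasTraceKernel K p q n) (h2 : (2 : K) ≠ 0) (hx₁ : Transcendental K (x 1))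
    (hx : ∀ i, 1 ≤ i → traceSum q n (x (i + 1)) =
      towerStep (algebraMap K L (algebraMap k K α)) (traceSum q n (x i)))
    {i : ℕ} (hi : 1 ≤ i) {c : towerField K x i} (hc : IsAlgebraic K c) :
    ∃ a : K, algebraMap K (towerField K x i) a = c := by
  obtain ⟨N, rfl⟩ : ∃ N, i = N + 1 := ⟨i - 1, by omega⟩
  obtain ⟨φ, -⟩ := exists_algHom_fractionRing_powerSeries h h2 hx₁ hx
    (Ω := K) (b := fun m => algebraMap k K ((towerStep α)^[m] 0)) (N := N) (fun m _ => by
      simp only [Function.iterate_succ_apply', towerStep]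
      set y := (towerStep α)^[m] 0
      have hy : y ^ 2 - α ≠ 0 := fun h0 => hα ⟨y, by rw [← pow_two, sub_eq_zero.1 h0]⟩
      simp only [Algebra.algebraMap_self, RingHom.id_apply]
      rw [← map_pow, ← map_sub, ← map_mul, one_div, inv_mul_cancel₀ hy, map_one])
    fun m _ => exists_traceSum_eq hk hK _
  have hint : IsIntegral (PowerSeries K) (φ c) := (hc.isIntegral.map φ).tower_top
  obtain ⟨f, hf⟩ := IsIntegrallyClosed.isIntegral_iff.1 hint
  have hfalg : IsAlgebraic K f := by
    rw [← isAlgebraic_algebraMap_iff (IsFractionRing.injective (PowerSeries K)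
      (FractionRing (PowerSeries K))), hf]
    exact hc.algHom φ
  refine ⟨PowerSeries.constantCoeff f, (φ : _ →+* FractionRing (PowerSeries K)).injective ?_⟩
  have h0 : f - algebraMap K (PowerSeries K) (PowerSeries.constantCoeff f) = 0 :=
    powerSeries_eq_zero_of_isAlgebraic (K := K) (hfalg.sub (isAlgebraic_algebraMap _))
      (by simp)
  rw [RingHom.coe_coe, φ.commutes,
    IsScalarTower.algebraMap_apply K (PowerSeries K) (FractionRing (PowerSeries K)),
    ← sub_eq_zero.1 h0, hf]

end Tower

end FunctionFieldTower

/-! ### Places of the tower -/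

namespace FunctionFieldTower

open Polynomial IntermediateField

section Step

variable {k E : Type*} [Field k] [Field E] {α : k} {V : ValuationSubring E} {z : E}

/-- The element `z` has a residue in `k` at `V`, or it has a pole there. -/
def TraceResidueIn (ι : k →+* E) (V : ValuationSubring E) (z : E) : Prop :=
  (∃ d : k, z - ι d ∈ V.nonunits) ∨ z ∉ V

/-- If `z` has the residue `d`, then `1 / (z ^ 2 - α)` has the residue `1 / (d ^ 2 - α)`, where
`d ^ 2 ≠ α` as `α` is not a square; if `z` has a pole, it has the residue `0`. -/
theorem TraceResidueIn.towerStep {ι : k →+* E} (hα : ¬ IsSquare α) (hV : ∀ a, ι a ∈ V)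
    (hz : TraceResidueIn ι V z) : ∃ d : k, towerStep (ι α) z - ι d ∈ V.nonunits := by
  rcases hz with ⟨d, hd⟩ | hz
  · have hD : d ^ 2 - α ≠ 0 := fun h0 => hα ⟨d, by rw [← pow_two, sub_eq_zero.1 h0]⟩
    have hzV : z ∈ V := by
      rw [← sub_add_cancel z (ι d)]
      exact add_mem (V.nonunits_subset hd) (hV d)
    have hsub : ι (d ^ 2 - α) - (z ^ 2 - ι α) ∈ V.nonunits := by
      have : ι (d ^ 2 - α) - (z ^ 2 - ι α) = -(z + ι d) * (z - ι d) := by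
        rw [map_sub, map_pow]; ring
      rw [this]
      exact mul_mem_nonunits (neg_mem (add_mem hzV (hV d))) hd
    have hy : z ^ 2 - ι α ∉ V.nonunits := fun hy => by
      have h1 := add_mem hsub hy
      rw [sub_add_cancel] at h1
      let := ι.toAlgebra
      exact hD (eq_zero_of_algebraMap_mem_nonunits (K := k) hV h1)
    rw [V.mem_nonunits_iff_or, not_or, not_not] at hy
    have hD' : ι (d ^ 2 - α) ≠ 0 := (_root_.map_ne_zero ι).2 hD
    refine ⟨(d ^ 2 - α)⁻¹, ?_⟩
    have : FunctionFieldTower.towerStep (ι α) z - ι (d ^ 2 - α)⁻¹ =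
        (z ^ 2 - ι α)⁻¹ * ι (d ^ 2 - α)⁻¹ * (ι (d ^ 2 - α) - (z ^ 2 - ι α)) := by
      rw [FunctionFieldTower.towerStep, map_inv₀]
      have := hy.1
      field_simp
    rw [this]
    exact mul_mem_nonunits (mul_mem hy.2 (hV _)) hsub
  · refine ⟨0, ?_⟩
    rw [map_zero, sub_zero, FunctionFieldTower.towerStep, one_div, V.inv_mem_nonunits_iff]
    refine Or.inr fun hy => hz ?_
    have hz0 : z ≠ 0 := by rintro rfl; exact hz V.zero_mem
    have hzi := (V.mem_or_inv_mem z).resolve_left hz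
    have hz2 : z ^ 2 ∈ V := by
      rw [← sub_add_cancel (z ^ 2) (ι α)]
      exact add_mem hy (hV α)
    have : z = z ^ 2 * z⁻¹ := by field_simp
    rw [this]
    exact mul_mem hz2 hzi

theorem TraceResidueIn.iterate_towerStep {ι : k →+* E} (hα : ¬ IsSquare α) (hV : ∀ a, ι a ∈ V)
    (hz : TraceResidueIn ι V z) (m : ℕ) :
    ∃ d : k, (FunctionFieldTower.towerStep (ι α))^[m + 1] z - ι d ∈ V.nonunits := by
  induction m with
  | zero => exact hz.towerStep hα hV
  | succ m ih =>
    rw [Function.iterate_succ_apply']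
    exact TraceResidueIn.towerStep hα hV (Or.inl ih)

end Step

section Place

variable {K L : Type*} [Field K] [Field L] [Algebra K L]

theorem Place.exists_sub_mem_nonunits_of_isRational {F : Type*} [Field F] [Algebra K F]
    {P : Place K F} (hP : P.IsRational) {y : F} (hy : y ∈ P.ring) :
    ∃ c : K, y - algebraMap K F c ∈ P.ring.nonunits := by
  have h1 : Module.finrank K (IsLocalRing.ResidueField P.ring) = 1 := hP
  obtain ⟨c, hc⟩ := (finrank_eq_one_iff_of_nonzero' (1 : IsLocalRing.ResidueField P.ring)
    one_ne_zero).1 h1 (IsLocalRing.residue _ ⟨y, hy⟩)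
  refine ⟨c, ?_⟩
  have h2 : IsLocalRing.residue P.ring (⟨y, hy⟩ - algebraMap K P.ring c) = 0 := by
    rw [map_sub, ← hc, Algebra.smul_def, mul_one, sub_eq_zero]
    rfl
  rw [IsLocalRing.residue_eq_zero_iff, ← ValuationSubring.coe_mem_nonunits_iff] at h2
  exact h2

variable {F E : IntermediateField K L}

/-- The identity map between `E`, seen as an intermediate field of `L / F`, and `E` itself. -/
def extendScalarsEquiv (h : F ≤ E) : extendScalars h ≃+* E := RingEquiv.refl E

/-- The conditions in the definition of a place need not be imposed on a valuation ring
above one. -/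
theorem Place.encard_liesOver (h : F ≤ E) (P : Place K F) :
    {P' : Place K E | P'.LiesOver h P}.encard =
      {V : ValuationSubring (extendScalars h) |
        V.comap (algebraMap F (extendScalars h)) = P.ring}.encard := by
  let e := extendScalarsEquiv h
  have hinj : Function.Injective fun P' : Place K E =>
      P'.ring.comap (e : extendScalars h →+* E) := by
    rintro ⟨R, _, _⟩ ⟨R', _, _⟩ hRR
    have hR : R = R' := ValuationSubring.ext _ _ fun y => SetLike.ext_iff.1 hRR (e.symm y)
    subst hR
    rfl
  rw [← hinj.encard_image]
  congr 1
  ext V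
  constructor
  · rintro ⟨P', hP', rfl⟩
    exact hP'
  · intro hV
    have hV' : V.comap (algebraMap F (extendScalars h)) = P.ring := hV
    refine ⟨⟨V.comap (e.symm : E →+* extendScalars h), fun a => ?_,
      fun htop => P.ne_top ?_⟩, ?_, ?_⟩
    · have := P.algebraMap_mem a
      rw [← hV'] at this
      exact this
    · rw [← hV']
      ext a
      have : (inclusion h a) ∈ V.comap (e.symm : E →+* extendScalars h) :=
        htop ▸ ValuationSubring.mem_top _
      exact ⟨fun _ => ValuationSubring.mem_top _, fun _ => this⟩
    · exact hV'
    · rfl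

/-- If `m_P` generates `m_P'`, the extension is unramified. In case `m_P' = m_P' ^ 2`, every
exponent satisfies the condition in the definition of the ramification index, which is then the
supremum of an unbounded set, equal to `0` by convention; this does not happen for discrete
valuations. -/
theorem Place.LiesOver.ramificationIndex_le_one {h : F ≤ E} {P' : Place K E} {P : Place K F}
    (hP : P'.LiesOver h P) (hle : IsLocalRing.maximalIdeal P'.ring ≤
      Ideal.map hP.ringHom (IsLocalRing.maximalIdeal P.ring)) : hP.ramificationIndex ≤ 1 := by
  by_contra! hlt
  rw [Place.LiesOver.ramificationIndex] at hlt
  set s := {m : ℕ | Ideal.map hP.ringHom (IsLocalRing.maximalIdeal P.ring) ≤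
    IsLocalRing.maximalIdeal P'.ring ^ m} with hs
  have hne : s.Nonempty := by
    by_contra hne
    rw [Set.not_nonempty_iff_eq_empty.1 hne, csSup_empty] at hlt
    simp at hlt
  obtain ⟨m, hm, h1m⟩ := exists_lt_of_lt_csSup hne hlt
  have hsq : IsLocalRing.maximalIdeal P'.ring ≤ IsLocalRing.maximalIdeal P'.ring ^ 2 :=
    (hle.trans hm).trans (Ideal.pow_le_pow_right h1m)
  have hpow : ∀ l : ℕ, IsLocalRing.maximalIdeal P'.ring ≤
      IsLocalRing.maximalIdeal P'.ring ^ (l + 1) := by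
    intro l
    induction l with
    | zero => simp
    | succ l ih =>
      calc _ ≤ IsLocalRing.maximalIdeal P'.ring ^ 2 := hsq
        _ = IsLocalRing.maximalIdeal P'.ring * IsLocalRing.maximalIdeal P'.ring := pow_two _
        _ ≤ IsLocalRing.maximalIdeal P'.ring ^ (l + 1) * IsLocalRing.maximalIdeal P'.ring :=
          Ideal.mul_mono_left ih
        _ = _ := (pow_succ _ _).symm
  have hmap : Ideal.map hP.ringHom (IsLocalRing.maximalIdeal P.ring) ≤
      IsLocalRing.maximalIdeal P'.ring := hm.trans (Ideal.pow_le_self (by omega))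
  have hunb : ¬ BddAbove s := by
    rintro ⟨B, hB⟩
    have := hB (show B + 1 ∈ s from hmap.trans (hpow B))
    omega
  rw [Nat.sSup_of_not_bddAbove hunb] at hlt
  omega

theorem Place.LiesOver.ramificationIndex_le_one_of_traceSum {p q n : ℕ}
    (hK : HasTraceKernel K p q n) {h : F ≤ E} {P' : Place K E} {P : Place K F}
    (hP : P'.LiesOver h P) {x : L} (hX : extendScalars h = F⟮x⟯) {z : F} (hz : z ∈ P.ring)
    (hx : traceSum q n x = z) : hP.ramificationIndex ≤ 1 := by
  refine hP.ramificationIndex_le_one fun y hy => ?_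
  have hxE : x ∈ extendScalars h := hX ▸ mem_adjoin_simple_self F x
  set x' : extendScalars h := ⟨x, hxE⟩
  have htop : adjoin F {x'} = ⊤ := by
    have := adjoin_preimage_eq_top hX
    have hset : ((↑) ⁻¹' {x} : Set (extendScalars h)) = {x'} := by
      ext w; simp [x', Subtype.ext_iff]
    rwa [hset] at this
  have hx' : traceSum q n x' = algebraMap F (extendScalars h) z := by
    apply (algebraMap (extendScalars h) L).injective
    rw [map_traceSum]
    exact hx
  let e := extendScalarsEquiv h
  have hy' : e.symm y ∈ (P'.ring.comap (e : extendScalars h →+* E)).nonunits := by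
    have h1 := ValuationSubring.coe_mem_nonunits_iff.2 hy
    rw [ValuationSubring.mem_nonunits_iff_or] at h1 ⊢
    exact h1
  obtain ⟨N, a, w, ha, hw, hsum⟩ := hK.exists_eq_sum_mul htop (O := P.ring) P.algebraMap_mem hz hx'
    (V := P'.ring.comap (e : extendScalars h →+* E)) hP hy'
  have haP : ∀ l, a l ∈ P.ring := fun l => P.ring.nonunits_subset (ha l)
  have hyw : y = ∑ l ∈ Finset.range N, hP.ringHom ⟨a l, haP l⟩ * ⟨e (w l), hw l⟩ := by
    apply Subtype.ext
    have := congrArg e hsum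
    rw [RingEquiv.apply_symm_apply, map_sum] at this
    rw [this, AddSubmonoidClass.coe_finsetSum]
    exact Finset.sum_congr rfl fun l _ => map_mul e _ _
  rw [hyw]
  refine sum_mem fun l _ => Ideal.mul_mem_right _ _ (Ideal.mem_map_of_mem _ ?_)
  exact ValuationSubring.coe_mem_nonunits_iff.1 (ha l)

end Place

section Splitting

variable {k K L : Type*} [Field k] [Field K] [Algebra k K] [Field L] [Algebra K L] {x : ℕ → L}
  {α : k} {p q n : ℕ}

/-- At a rational place, every trace has its residue in `k` or a pole, since the trace maps `K` to
`k`. -/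
theorem Place.IsRational.traceResidueIn [Finite k] [Finite K] (hk : Nat.card k = q)
    (hK : Nat.card K = q ^ n) (h : HasTraceKernel K p q n) {F : Type*} [Field F] [Algebra K F]
    {P : Place K F} (hP : P.IsRational) (y : F) :
    TraceResidueIn ((algebraMap K F).comp (algebraMap k K)) P.ring (traceSum q n y) := by
  by_cases hy : y ∈ P.ring
  · obtain ⟨c, hc⟩ := P.exists_sub_mem_nonunits_of_isRational hP hy
    refine Or.inl ⟨Algebra.trace k K c, ?_⟩
    rw [RingHom.comp_apply, ← traceSum_eq_trace hk hK, map_traceSum, ← h.traceSum_sub, traceSum]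
    refine sum_mem fun j _ => ?_
    rw [← Nat.sub_add_cancel (Nat.one_le_pow j q (by have := h.one_lt; omega)), pow_succ]
    exact mul_mem_nonunits (pow_mem (P.ring.nonunits_subset hc) _) hc
  · exact Or.inr fun hS => hy (h.mem_of_traceSum_mem hS)

theorem splitsCompletelyIn_of_traceResidueIn [Finite k] [Finite K] (hk : Nat.card k = q)
    (hK : Nat.card K = q ^ n) (hα : ¬ IsSquare α) (h : HasTraceKernel K p q n)
    (hx : ∀ i, 1 ≤ i → traceSum q n (x (i + 1)) =
      towerStep (algebraMap K L (algebraMap k K α)) (traceSum q n (x i)))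
    {i j : ℕ} (hi : 1 ≤ i) (hij : i ≤ j) {P : Place K (towerField K x i)}
    (hP : TraceResidueIn ((algebraMap K (towerField K x i)).comp (algebraMap k K)) P.ring
      (traceSum q n ⟨x i, mem_towerField hi le_rfl⟩)) :
    P.SplitsCompletelyIn (towerField_mono K x hij) := by
  have hXz := exists_traceSum_stepGenerators hx hi hij
  refine ⟨h.finiteDimensional (finite_stepGenerators hij) (adjoin_stepGenerators hij) hXz, ?_⟩
  rw [Place.encard_liesOver, h.encard_comap_eq (finite_stepGenerators hij)
    (adjoin_stepGenerators hij) hXz P.algebraMap_mem]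
  intro V hV y hy
  obtain ⟨m, hm⟩ := traceSum_stepGenerators hx hi hij y hy
  obtain ⟨d, hd⟩ := hP.iterate_towerStep hα (fun a => P.algebraMap_mem _) m
  obtain ⟨c, hc⟩ := exists_traceSum_eq hk hK d
  refine h.exists_sub_mem_nonunits (c := c) ?_
  rw [← algebraMap_mem_nonunits_iff hV, map_sub] at hd
  rw [hm, hc]
  exact hd

theorem algebraMap_towerStep_traceSum {β : K}
    (hx : ∀ i, 1 ≤ i → traceSum q n (x (i + 1)) =
      towerStep (algebraMap K L β) (traceSum q n (x i))) {i : ℕ} (hi : 1 ≤ i) :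
    algebraMap (towerField K x i) L (towerStep (algebraMap K (towerField K x i) β)
      (traceSum q n ⟨x i, mem_towerField hi le_rfl⟩)) = traceSum q n (x (i + 1)) := by
  rw [hx i hi, towerStep, towerStep, map_div₀, map_one, map_sub, map_pow, map_traceSum]
  rfl

/-- A place that ramifies in the next step is a pole of the right-hand side of its equation. -/
theorem towerStep_notMem_of_isRamifiedIn {β : K} (h : HasTraceKernel K p q n)
    (hx : ∀ i, 1 ≤ i → traceSum q n (x (i + 1)) =
      towerStep (algebraMap K L β) (traceSum q n (x i)))
    {i : ℕ} (hi : 1 ≤ i) {P : Place K (towerField K x i)}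
    (hP : P.IsRamifiedIn (towerField_mono K x (Nat.le_succ i))) :
    towerStep (algebraMap K (towerField K x i) β)
      (traceSum q n ⟨x i, mem_towerField hi le_rfl⟩) ∉ P.ring := by
  obtain ⟨P', hP', he⟩ := hP
  intro hz
  have hset : x '' Set.Icc (i + 1) i.succ = {x (i + 1)} := by simp
  refine absurd (hP'.ramificationIndex_le_one_of_traceSum h
    ((extendScalars_towerField (Nat.le_succ i)).trans (by rw [hset])) hz
    (algebraMap_towerStep_traceSum hx hi).symm) (not_le.2 he)

end Splitting

end FunctionFieldTower

theorem mainTheorem4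
    (p q n : ℕ) [Fact p.Prime] (hp : p ≠ 2) (hn : 1 < n)
    {k K : Type*} [Field k] [Field K] [Finite k] [Finite K] [Algebra k K] [CharP k p]
    (hk : Nat.card k = q) (hK : Nat.card K = q ^ n)
    (α : k) (hα : ¬ IsSquare α)
    {L : Type*} [Field L] [Algebra K L]
    (x : ℕ → L) (hx₁ : Transcendental K (x 1))
    (hx : ∀ i, 1 ≤ i →
      FunctionFieldTower.traceSum q n (x (i + 1)) =
        1 / (FunctionFieldTower.traceSum q n (x i) ^ 2 -
          algebraMap K L (algebraMap k K α))) :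
    -- the defining equations are irreducible: each step has degree `q ^ (n - 1)`
    (∀ i, 1 ≤ i →
      Module.finrank (FunctionFieldTower.towerField K x i)
        (IntermediateField.extendScalars
          (FunctionFieldTower.towerField_mono K x (Nat.le_succ i))) = q ^ (n - 1)) ∧
    -- `K` is the full constant field of every `T_i`
    (∀ i, 1 ≤ i → ∀ c : FunctionFieldTower.towerField K x i, IsAlgebraic K c →
      ∃ a : K, algebraMap K (FunctionFieldTower.towerField K x i) a = c) ∧
    -- `T_i / T_1` is an abelian extension
    (∀ i, ∀ hi : 1 ≤ i,
      FiniteDimensional (FunctionFieldTower.towerField K x 1)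
        (IntermediateField.extendScalars (FunctionFieldTower.towerField_mono K x hi)) ∧
      IsAbelianGalois (FunctionFieldTower.towerField K x 1)
        (IntermediateField.extendScalars (FunctionFieldTower.towerField_mono K x hi))) ∧
    -- every rational place of every `T_i` splits completely in every `T_j`, `j ≥ i`
    (∀ i j, 1 ≤ i → ∀ hij : i ≤ j,
      ∀ P : FunctionFieldTower.Place K (FunctionFieldTower.towerField K x i),
        P.IsRational →
          P.SplitsCompletelyIn (FunctionFieldTower.towerField_mono K x hij)) ∧
    -- a place of `T_i` that ramifies in `T_{i+1}` is not rational, and every place of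
    -- `T_{i+1}` over it splits completely in every `T_j`, `j ≥ i + 1`
    (∀ i, 1 ≤ i →
      ∀ P : FunctionFieldTower.Place K (FunctionFieldTower.towerField K x i),
        P.IsRamifiedIn (FunctionFieldTower.towerField_mono K x (Nat.le_succ i)) →
          ¬ P.IsRational ∧
          ∀ P' : FunctionFieldTower.Place K (FunctionFieldTower.towerField K x (i + 1)),
            P'.LiesOver (FunctionFieldTower.towerField_mono K x (Nat.le_succ i)) P →
              ∀ j, ∀ hj : i + 1 ≤ j,
                P'.SplitsCompletelyIn (FunctionFieldTower.towerField_mono K x hj)) := by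
  have h : FunctionFieldTower.HasTraceKernel K p q n :=
    FunctionFieldTower.hasTraceKernel_of_card (by omega) hk hK
  have h2 : (2 : K) ≠ 0 := by
    have := h.charP
    exact Ring.two_ne_zero (by rwa [ringChar.eq K p])
  have hx' : ∀ i, 1 ≤ i → FunctionFieldTower.traceSum q n (x (i + 1)) =
      FunctionFieldTower.towerStep (algebraMap K L (algebraMap k K α))
        (FunctionFieldTower.traceSum q n (x i)) := hx
  refine ⟨fun i hi => FunctionFieldTower.finrank_towerField_succ hα h h2 hx₁ hx' hi,
    fun i hi c hc =>
      FunctionFieldTower.mem_range_algebraMap_of_isAlgebraic hk hK hα h h2 hx₁ hx' hi hc,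
    fun i hi => ?_, fun i j hi hij P hP =>
      FunctionFieldTower.splitsCompletelyIn_of_traceResidueIn hk hK hα h hx' hi hij
        (hP.traceResidueIn hk hK h _), fun i hi P hP => ?_⟩
  · have hadj := FunctionFieldTower.adjoin_stepGenerators (K := K) (x := x) hi
    have hz := FunctionFieldTower.exists_traceSum_stepGenerators hx' le_rfl hi
    exact ⟨h.finiteDimensional (FunctionFieldTower.finite_stepGenerators hi) hadj hz,
      h.isAbelianGalois hadj hz⟩
  · have hpole := FunctionFieldTower.towerStep_notMem_of_isRamifiedIn h hx' hi hP
    refine ⟨fun hrat => hpole ?_, fun P' hP' j hj =>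
      FunctionFieldTower.splitsCompletelyIn_of_traceResidueIn hk hK hα h hx' (by omega) hj
        (Or.inr fun hmem => hpole ?_)⟩
    · obtain ⟨d, hd⟩ := (hrat.traceResidueIn hk hK h
        ⟨x i, FunctionFieldTower.mem_towerField hi le_rfl⟩).towerStep hα fun a => P.algebraMap_mem _
      have := add_mem (P.ring.nonunits_subset hd) (P.algebraMap_mem (algebraMap k K d))
      rwa [← RingHom.comp_apply, sub_add_cancel] at this
    · rw [← hP', ValuationSubring.mem_comap]
      convert hmem using 1
      apply Subtype.ext
      exact (FunctionFieldTower.algebraMap_towerStep_traceSum hx' hi).trans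
        (FunctionFieldTower.map_traceSum (algebraMap (FunctionFieldTower.towerField K x (i + 1)) L)
          q n ⟨x (i + 1), FunctionFieldTower.mem_towerField (by omega) le_rfl⟩).symm
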